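/- Let $\widetilde{D^\infty W_1}=\bigwedge[h_{(a)}]_{a\ge 0}\otimes\mathbb{R}[c_{(b)}]_{b\ge 0}$ be the differential graded algebra over $\mathbb{R}$ with $\deg h_{(a)}=1$, $\deg c_{(b)}=2$, and differential given by $d h_{(a)}=c_{(a)}$, $d c_{(b)}=0$. Let $\delta$ and $\sigma$ be the unsigned derivations of this algebra with $$\delta(h_{(a)})=h_{(a+1)},\quad \delta(c_{(a)})=c_{(a+1)},\qquad \sigma(h_{(a)})=\tfrac12 a(a-1)h_{(a-1)},\quad \sigma(c_{(a)})=\tfrac12 a(a-1)c_{(a-1)},$$ where $h_{(-1)}=c_{(-1)}=0$. The order of a monomial is the sum of the indices of its factors: $\operatorname{ord}h_{(a)}=a$, $\operatorname{ord}c_{(b)}=b$. The norm of a monomial is additive, with $\|c_{(b)}\|=\max\{1-b,0\}$, $\|h_{(0)}\|=0$ and $\|h_{(a)}\|=\max\{1-a,0\}$ for $a\ge1$. Let $\mathscr{I}$ be the ideal generated by all $\delta^k x$ with $k\ge0$ and $x$ a monomial of norm greater than $1$ (equivalently, the ideal generated by the elements $\delta^k(c_{(0)}^2)$, $k\ge 0$),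 and let $D^\infty W_1=\widetilde{D^\infty W_1}/\mathscr{I}$. The maps $d$, $\delta$ and $\sigma$ preserve $\mathscr{I}$, and $\delta$ and $\sigma$ commute with $d$, so $\delta$ and $\sigma$ act on the total cohomology $H^*(D^\infty W_1)$. Let $H^*(D^\infty W_1)^k$ be the subspace of the classes of cocycles of order $k$ (a cochain has order $k$ if it is represented by a linear combination of monomials of order $k$), and for $\lambda\in\mathbb{R}$ let $$F_{\lambda,k}=\{\gamma\in H^*(D^\infty W_1)^k \mid \delta(\sigma(\gamma))=\lambda\gamma\}.$$ Then $F_{0,2}=\{0\}$, $F_{0,3}=\{0\}$ and $F_{0,4}=\{0\}$. -/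

import Mathlib

open scoped TensorProduct

noncomputable section

namespace DefW

/-- The exterior algebra over the real numbers on generators `h_(0), h_(1), h_(2), …`. -/
abbrev HAlg : Type := ExteriorAlgebra ℝ (ℕ →₀ ℝ)

/-- The polynomial algebra over the real numbers in variables `c_(0), c_(1), c_(2), …`. -/
abbrev CAlg : Type := MvPolynomial ℕ ℝ

/-- The algebra `⋀[h_(a)] ⊗ ℝ[c_(b)]`, with `a, b ≥ 0`, before dividing out any relation. As the
`c_(b)` have degree two, the ordinary product of the tensor product is the graded one. -/
abbrev Free : Type := HAlg ⊗[ℝ] CAlg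

/-- The inclusion of the span of the `h_(a)` into the exterior algebra. -/
abbrev hLin : (ℕ →₀ ℝ) →ₗ[ℝ] HAlg := ExteriorAlgebra.ι ℝ

/-- The linear map that sends the `a`-th basis vector to `c_(a)`. -/
def cLin : (ℕ →₀ ℝ) →ₗ[ℝ] CAlg := Finsupp.linearCombination ℝ (fun a => MvPolynomial.X a)

/-- The monomial `h_(l₁) ⋯ h_(lₙ) · ∏ c_(b) ^ m(b)`. -/
def mono (l : List ℕ) (m : ℕ →₀ ℕ) : Free :=
  (l.map fun a => hLin (Finsupp.single a 1)).prod ⊗ₜ[ℝ] MvPolynomial.monomial m (1 : ℝ)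

/-! ### Unsigned derivations -/

/-- The recursion step of `hDer`: the pair `(x, Dx)` is sent to `f(v) x + v (Dx)`. -/
def hDerStep (f : (ℕ →₀ ℝ) →ₗ[ℝ] (ℕ →₀ ℝ)) : (ℕ →₀ ℝ) →ₗ[ℝ] HAlg × HAlg →ₗ[ℝ] HAlg :=
  ((LinearMap.mul ℝ HAlg ∘ₗ hLin) ∘ₗ f).compl₂ (LinearMap.fst ℝ HAlg HAlg) +
    (LinearMap.mul ℝ HAlg ∘ₗ hLin).compl₂ (LinearMap.snd ℝ HAlg HAlg)

theorem hDerStep_apply (f : (ℕ →₀ ℝ) →ₗ[ℝ] (ℕ →₀ ℝ)) (v : ℕ →₀ ℝ) (x y : HAlg) :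
    hDerStep f v (x, y) = hLin (f v) * x + hLin v * y := rfl

theorem hLin_sq (v : ℕ →₀ ℝ) : hLin v * hLin v = 0 := ExteriorAlgebra.ι_sq_zero v

theorem hDerStep_sq (f : (ℕ →₀ ℝ) →ₗ[ℝ] (ℕ →₀ ℝ)) (v : ℕ →₀ ℝ) (x y : HAlg) :
    hDerStep f v (hLin v * x, hDerStep f v (x, y)) = (0 : QuadraticForm ℝ (ℕ →₀ ℝ)) v • y := by
  have h : hLin (f v) * hLin v + hLin v * hLin (f v) = 0 := ExteriorAlgebra.ι_add_mul_swap _ _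
  simp only [hDerStep_apply, mul_add, ← mul_assoc, hLin_sq, zero_mul, add_zero]
  rw [← add_mul, h, zero_mul]
  simp

/-- The unsigned derivation of the exterior algebra that extends the linear map `f` on the span of
the generators. -/
def hDer (f : (ℕ →₀ ℝ) →ₗ[ℝ] (ℕ →₀ ℝ)) : HAlg →ₗ[ℝ] HAlg :=
  CliffordAlgebra.foldr' 0 (hDerStep f) (hDerStep_sq f) 0

/-- The linear map that sends the `a`-th basis vector to `u a` times the `s a`-th one. -/
def shift (u : ℕ → ℝ) (s : ℕ → ℕ) : (ℕ →₀ ℝ) →ₗ[ℝ] (ℕ →₀ ℝ) :=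
  Finsupp.linearCombination ℝ (fun a => Finsupp.single (s a) (u a))

/-- The derivation of the polynomial algebra with `c_(a) ↦ u a · c_(s a)`. -/
def cDer (u : ℕ → ℝ) (s : ℕ → ℕ) : Derivation ℝ CAlg CAlg :=
  MvPolynomial.mkDerivation ℝ (fun a => u a • MvPolynomial.X (s a))

/-- The unsigned derivation of `⋀[h_(a)] ⊗ ℝ[c_(b)]` with `h_(a) ↦ u a · h_(s a)` and
`c_(a) ↦ u a · c_(s a)`. -/
def der (u : ℕ → ℝ) (s : ℕ → ℕ) : Free →ₗ[ℝ] Free :=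
  TensorProduct.map (hDer (shift u s)) LinearMap.id +
    TensorProduct.map LinearMap.id (cDer u s).toLinearMap

/-- The derivation `δ` with `h_(a) ↦ h_(a+1)`, `c_(a) ↦ c_(a+1)`. -/
def deltaFree : Free →ₗ[ℝ] Free := der (fun _ => 1) (fun a => a + 1)

/-- The derivation `σ` with `h_(a) ↦ ½ a (a - 1) h_(a-1)`, `c_(a) ↦ ½ a (a - 1) c_(a-1)`; the
value on `h_(0)` and `c_(0)` is zero because the coefficient is. -/
def sigmaFree : Free →ₗ[ℝ] Free := der (fun a => (1 / 2 : ℝ) * a * (a - 1)) (fun a => a - 1)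

/-! ### The differential -/

/-- The recursion step of `dH`: the pair `(x, dx)` is sent to `c(v) x - v (dx)`. -/
def dStep : (ℕ →₀ ℝ) →ₗ[ℝ] HAlg × Free →ₗ[ℝ] Free :=
  (LinearMap.mul ℝ Free ∘ₗ Algebra.TensorProduct.includeRight.toLinearMap ∘ₗ cLin).compl₂
      (Algebra.TensorProduct.includeLeft.toLinearMap ∘ₗ LinearMap.fst ℝ HAlg Free) +
    (LinearMap.mul ℝ Free ∘ₗ Algebra.TensorProduct.includeLeft.toLinearMap ∘ₗ (-hLin)).compl₂
      (LinearMap.snd ℝ HAlg Free)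

theorem dStep_apply (v : ℕ →₀ ℝ) (x : HAlg) (y : Free) :
    dStep v (x, y) = x ⊗ₜ[ℝ] cLin v - (hLin v ⊗ₜ[ℝ] (1 : CAlg)) * y := by
  simp [dStep, sub_eq_add_neg]

theorem dStep_sq (v : ℕ →₀ ℝ) (x : HAlg) (y : Free) :
    dStep v (hLin v * x, dStep v (x, y)) = (0 : QuadraticForm ℝ (ℕ →₀ ℝ)) v • y := by
  simp only [dStep_apply, mul_sub, ← mul_assoc, Algebra.TensorProduct.tmul_mul_tmul, one_mul,
    hLin_sq, TensorProduct.zero_tmul, zero_mul]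
  simp

/-- The restriction of the differential to the exterior algebra. -/
def dH : HAlg →ₗ[ℝ] Free := CliffordAlgebra.foldr' 0 dStep dStep_sq 0

/-- The differential `d` of `⋀[h_(a)] ⊗ ℝ[c_(b)]`: the signed derivation with `d h_(a) = c_(a)` and
`d c_(a) = 0`. -/
def dFree : Free →ₗ[ℝ] Free :=
  TensorProduct.lift ((LinearMap.mul ℝ Free).compl₁₂ dH
    (Algebra.TensorProduct.includeRight : CAlg →ₐ[ℝ] Free).toLinearMap)

/-! ### Order, norm and the ideal of relations -/

/-- The order of a monomial: `ord h_(a) = a` and `ord c_(b) = b`, extended additively. -/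
def ordMono (l : List ℕ) (m : ℕ →₀ ℕ) : ℕ := l.sum + m.sum (fun b e => e * b)

/-- The norm of a monomial for `q = 1`: `‖c_(b)‖ = max (1 - b) 0`, `‖h_(0)‖ = 0` and
`‖h_(a)‖ = max (1 - a) 0` if `a ≥ 1`, extended additively (natural-number subtraction is the
truncated one that is meant). -/
def normMono (l : List ℕ) (m : ℕ →₀ ℕ) : ℕ :=
  (l.map fun a => if a = 0 then 0 else 1 - a).sum + m.sum (fun b e => e * (1 - b))

/-- The two-sided ideal generated by all `δ^k x`, with `k ≥ 0` and `x` a monomial of norm greater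
than `q = 1`, as a linear subspace. -/
def relIdeal : Submodule ℝ Free :=
  Submodule.span ℝ {z | ∃ (k : ℕ) (l : List ℕ) (m : ℕ →₀ ℕ) (a b : Free),
    1 < normMono l m ∧ z = a * (deltaFree ^ k) (mono l m) * b}

/-! ### The maps leave the ideal invariant and commute with the differential -/

theorem hDer_ι_mul (f : (ℕ →₀ ℝ) →ₗ[ℝ] (ℕ →₀ ℝ)) (v : ℕ →₀ ℝ) (x : HAlg) :
    hDer f (hLin v * x) = hLin (f v) * x + hLin v * hDer f x :=
  CliffordAlgebra.foldr'_ι_mul 0 (hDerStep f) (hDerStep_sq f) 0 v x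

theorem hDer_algebraMap (f : (ℕ →₀ ℝ) →ₗ[ℝ] (ℕ →₀ ℝ)) (r : ℝ) :
    hDer f (algebraMap ℝ HAlg r) = 0 :=
  (CliffordAlgebra.foldr'_algebraMap 0 (hDerStep f) (hDerStep_sq f) 0 r).trans (smul_zero r)

theorem dH_ι_mul (v : ℕ →₀ ℝ) (x : HAlg) :
    dH (hLin v * x) = x ⊗ₜ[ℝ] cLin v - (hLin v ⊗ₜ[ℝ] (1 : CAlg)) * dH x :=
  (CliffordAlgebra.foldr'_ι_mul 0 dStep dStep_sq 0 v x).trans (dStep_apply v x (dH x))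

theorem dH_algebraMap (r : ℝ) : dH (algebraMap ℝ HAlg r) = 0 :=
  (CliffordAlgebra.foldr'_algebraMap 0 dStep dStep_sq 0 r).trans (smul_zero r)

/-- Induction on elements of the exterior algebra, one generator at a time. -/
theorem hInd {P : HAlg → Prop} (h0 : ∀ r, P (algebraMap ℝ HAlg r))
    (ha : ∀ x y, P x → P y → P (x + y)) (hm : ∀ x v, P x → P (hLin v * x)) (x : HAlg) : P x :=
  CliffordAlgebra.left_induction (Q := (0 : QuadraticForm ℝ (ℕ →₀ ℝ))) h0 ha
    (fun x v hx => hm x v hx) x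

theorem hDer_mul (f : (ℕ →₀ ℝ) →ₗ[ℝ] (ℕ →₀ ℝ)) (x y : HAlg) :
    hDer f (x * y) = hDer f x * y + x * hDer f y := by
  induction x using hInd with
  | h0 r => simp [hDer_algebraMap, ← Algebra.smul_def]
  | ha x z hx hz => simp only [add_mul, map_add, hx, hz]; abel
  | hm x v hx => rw [mul_assoc, hDer_ι_mul, hx, hDer_ι_mul]; noncomm_ring

theorem der_tmul (u : ℕ → ℝ) (s : ℕ → ℕ) (x : HAlg) (p : CAlg) :
    der u s (x ⊗ₜ p) = hDer (shift u s) x ⊗ₜ p + x ⊗ₜ cDer u s p := rfl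

theorem der_mul (u : ℕ → ℝ) (s : ℕ → ℕ) (x y : Free) :
    der u s (x * y) = der u s x * y + x * der u s y := by
  induction x using TensorProduct.induction_on with
  | zero => simp
  | add x z hx hz => simp only [add_mul, map_add, hx, hz]; abel
  | tmul x p =>
    induction y using TensorProduct.induction_on with
    | zero => simp
    | add y z hy hz => simp only [mul_add, map_add, hy, hz]; abel
    | tmul y r =>
      simp only [der_tmul, Algebra.TensorProduct.tmul_mul_tmul, hDer_mul, Derivation.leibniz,
        add_mul, mul_add, TensorProduct.add_tmul, TensorProduct.tmul_add, smul_eq_mul]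
      rw [mul_comm r (cDer u s p)]
      abel

theorem der_c (u : ℕ → ℝ) (s : ℕ → ℕ) (p : CAlg) :
    der u s ((1 : HAlg) ⊗ₜ p) = (1 : HAlg) ⊗ₜ cDer u s p := by
  have h : hDer (shift u s) (1 : HAlg) = 0 := by
    simpa using hDer_algebraMap (shift u s) 1
  rw [der_tmul, h, TensorProduct.zero_tmul, zero_add]

theorem dFree_tmul (x : HAlg) (p : CAlg) : dFree (x ⊗ₜ p) = dH x * ((1 : HAlg) ⊗ₜ p) := rfl

theorem dFree_mul_c (y : Free) (p : CAlg) :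
    dFree (y * ((1 : HAlg) ⊗ₜ p)) = dFree y * ((1 : HAlg) ⊗ₜ p) := by
  induction y using TensorProduct.induction_on with
  | zero => simp
  | add y z hy hz => simp only [add_mul, map_add, hy, hz]
  | tmul x r =>
    rw [Algebra.TensorProduct.tmul_mul_tmul, mul_one, dFree_tmul, dFree_tmul, mul_assoc,
      Algebra.TensorProduct.tmul_mul_tmul, mul_one]

theorem c_comm (p : CAlg) (y : Free) :
    ((1 : HAlg) ⊗ₜ[ℝ] p) * y = y * ((1 : HAlg) ⊗ₜ[ℝ] p) := by
  induction y using TensorProduct.induction_on with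
  | zero => simp
  | add y z hy hz => simp only [add_mul, mul_add, hy, hz]
  | tmul x r => simp [Algebra.TensorProduct.tmul_mul_tmul, mul_comm]

theorem dFree_ι_mul (v : ℕ →₀ ℝ) (y : Free) :
    dFree ((hLin v ⊗ₜ[ℝ] (1 : CAlg)) * y) =
      y * ((1 : HAlg) ⊗ₜ cLin v) - (hLin v ⊗ₜ[ℝ] (1 : CAlg)) * dFree y := by
  induction y using TensorProduct.induction_on with
  | zero => simp
  | add y z hy hz => simp only [add_mul, mul_add, map_add, hy, hz]; abel
  | tmul x r =>
    rw [Algebra.TensorProduct.tmul_mul_tmul, one_mul, dFree_tmul, dFree_tmul, dH_ι_mul, sub_mul,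
      Algebra.TensorProduct.tmul_mul_tmul, Algebra.TensorProduct.tmul_mul_tmul, mul_assoc,
      mul_comm (cLin v)]

theorem dFree_dH (x : HAlg) : dFree (dH x) = 0 := by
  induction x using hInd with
  | h0 r => simp [dH_algebraMap]
  | ha x z hx hz => simp only [map_add, hx, hz, add_zero]
  | hm x v hx => rw [dH_ι_mul, map_sub, dFree_ι_mul, hx, dFree_tmul, mul_zero, sub_zero, sub_self]

theorem dFree_dFree (y : Free) : dFree (dFree y) = 0 := by
  induction y using TensorProduct.induction_on with
  | zero => simp
  | add y z hy hz => simp only [map_add, hy, hz, add_zero]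
  | tmul x p => rw [dFree_tmul, dFree_mul_c, dFree_dH, zero_mul]

theorem cDer_cLin (u : ℕ → ℝ) (s : ℕ → ℕ) (v : ℕ →₀ ℝ) :
    cDer u s (cLin v) = cLin (shift u s v) := by
  have h : (cDer u s).toLinearMap ∘ₗ cLin = cLin ∘ₗ shift u s := by
    ext a : 2
    simp [cDer, cLin, shift]
  exact LinearMap.congr_fun h v

theorem der_dH (u : ℕ → ℝ) (s : ℕ → ℕ) (x : HAlg) :
    der u s (dH x) = dH (hDer (shift u s) x) := by
  induction x using hInd with
  | h0 r => simp [dH_algebraMap, hDer_algebraMap]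
  | ha x z hx hz => simp only [map_add, hx, hz]
  | hm x v hx =>
    have h : der u s (hLin v ⊗ₜ[ℝ] (1 : CAlg)) = hLin (shift u s v) ⊗ₜ[ℝ] (1 : CAlg) := by
      have h1 := hDer_ι_mul (shift u s) v 1
      have h2 : hDer (shift u s) (1 : HAlg) = 0 := by simpa using hDer_algebraMap (shift u s) 1
      rw [h2, mul_one, mul_one, mul_zero, add_zero] at h1
      rw [der_tmul, h1]
      simp
    rw [dH_ι_mul, map_sub, der_mul, h, der_tmul, cDer_cLin, hx, hDer_ι_mul, map_add, dH_ι_mul,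
      dH_ι_mul]
    abel

theorem der_dFree (u : ℕ → ℝ) (s : ℕ → ℕ) (y : Free) :
    der u s (dFree y) = dFree (der u s y) := by
  induction y using TensorProduct.induction_on with
  | zero => simp
  | add y z hy hz => simp only [map_add, hy, hz]
  | tmul x p =>
    rw [dFree_tmul, der_mul, der_c, der_dH, der_tmul, map_add, dFree_tmul, dFree_tmul]

/-- The polynomial `δ^k (c_(0)²)`. -/
def rel (k : ℕ) : CAlg := (cDer (fun _ => 1) (fun a => a + 1))^[k] (MvPolynomial.X 0 ^ 2)

theorem rel_succ (k : ℕ) : rel (k + 1) = cDer (fun _ => 1) (fun a => a + 1) (rel k) :=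
  Function.iterate_succ_apply' _ _ _

theorem deltaFree_pow_rel (k : ℕ) :
    (deltaFree ^ k) ((1 : HAlg) ⊗ₜ[ℝ] (MvPolynomial.X 0 ^ 2 : CAlg)) = (1 : HAlg) ⊗ₜ[ℝ] rel k := by
  induction k with
  | zero => rfl
  | succ k ih => rw [pow_succ', Module.End.mul_apply, ih, deltaFree, der_c, rel_succ]

theorem ord_rel (k : ℕ) : cDer (fun a => (a : ℝ)) id (rel k) = (k : ℝ) • rel k := by
  induction k with
  | zero => simp [rel, cDer]
  | succ k ih =>
    have h : ⁅cDer (fun a => (a : ℝ)) id, cDer (fun _ => 1) (fun a => a + 1)⁆ =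
        cDer (fun _ => 1) (fun a => a + 1) := by
      apply MvPolynomial.derivation_ext
      intro a
      simp [Derivation.commutator_apply, cDer, MvPolynomial.mkDerivation_X, add_smul]
    have h1 := congrArg (fun D : Derivation ℝ CAlg CAlg => D (rel k)) h
    simp only [Derivation.commutator_apply, ih, Derivation.map_smul] at h1
    rw [← rel_succ] at h1
    rw [eq_add_of_sub_eq h1]
    push_cast
    module

theorem sigma_rel_zero :
    cDer (fun a => (1 / 2 : ℝ) * a * (a - 1)) (fun a => a - 1) (rel 0) = 0 := by
  simp [rel, cDer]

theorem sigma_rel_succ (k : ℕ) : ∃ r : ℝ,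
    cDer (fun a => (1 / 2 : ℝ) * a * (a - 1)) (fun a => a - 1) (rel (k + 1)) = r • rel k := by
  have h : ⁅cDer (fun a => (1 / 2 : ℝ) * a * (a - 1)) (fun a => a - 1),
      cDer (fun _ => 1) (fun a => a + 1)⁆ = cDer (fun a => (a : ℝ)) id := by
    apply MvPolynomial.derivation_ext
    intro a
    rcases a with _ | a
    · simp [Derivation.commutator_apply, cDer, MvPolynomial.mkDerivation_X]
    · simp only [Derivation.commutator_apply, cDer, MvPolynomial.mkDerivation_X, Derivation.map_smul,
        Nat.add_sub_cancel, one_smul, id_eq, ← sub_smul]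
      congr 1
      push_cast
      ring
  have hk (k : ℕ) := congrArg (fun D : Derivation ℝ CAlg CAlg => D (rel k)) h
  simp only [Derivation.commutator_apply, ← rel_succ, ord_rel] at hk
  induction k with
  | zero =>
    refine ⟨0, ?_⟩
    have := hk 0
    rw [sigma_rel_zero] at this
    simpa using this
  | succ k ih =>
    obtain ⟨r, hr⟩ := ih
    refine ⟨r + (k + 1 : ℕ), ?_⟩
    have := hk (k + 1)
    rw [hr, Derivation.map_smul, ← rel_succ] at this
    rw [eq_add_of_sub_eq this]
    module

/-- The ideal of relations is generated by the elements `δ^k (c_(0)²)`, which are central. -/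
theorem relIdeal_eq : relIdeal =
    Submodule.span ℝ {z | ∃ (k : ℕ) (y : Free), z = y * ((1 : HAlg) ⊗ₜ[ℝ] rel k)} := by
  apply le_antisymm
  · set J := Submodule.span ℝ {z | ∃ (k : ℕ) (y : Free), z = y * ((1 : HAlg) ⊗ₜ[ℝ] rel k)} with hJ
    have hl : ∀ a z, z ∈ J → a * z ∈ J := by
      intro a z hz
      induction hz using Submodule.span_induction with
      | mem z h =>
        obtain ⟨k, y, rfl⟩ := h
        exact Submodule.subset_span ⟨k, a * y, by rw [mul_assoc]⟩
      | zero => simp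
      | add x y _ _ hx hy => rw [mul_add]; exact J.add_mem hx hy
      | smul r x _ hx => rw [mul_smul_comm]; exact J.smul_mem r hx
    have hr : ∀ a z, z ∈ J → z * a ∈ J := by
      intro a z hz
      induction hz using Submodule.span_induction with
      | mem z h =>
        obtain ⟨k, y, rfl⟩ := h
        exact Submodule.subset_span ⟨k, y * a, by rw [mul_assoc, c_comm, mul_assoc]⟩
      | zero => simp
      | add x y _ _ hx hy => rw [add_mul]; exact J.add_mem hx hy
      | smul r x _ hx => rw [smul_mul_assoc]; exact J.smul_mem r hx
    have hd : ∀ z, z ∈ J → deltaFree z ∈ J := by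
      intro z hz
      induction hz using Submodule.span_induction with
      | mem z h =>
        obtain ⟨k, y, rfl⟩ := h
        rw [deltaFree, der_mul, der_c, ← rel_succ]
        exact J.add_mem (Submodule.subset_span ⟨k, _, rfl⟩) (Submodule.subset_span ⟨k + 1, _, rfl⟩)
      | zero => simp
      | add x y _ _ hx hy => rw [map_add]; exact J.add_mem hx hy
      | smul r x _ hx => rw [map_smul]; exact J.smul_mem r hx
    have hdk : ∀ k z, z ∈ J → (deltaFree ^ k) z ∈ J := by
      intro k z hz
      induction k with
      | zero => simpa using hz
      | succ k ih => rw [pow_succ', Module.End.mul_apply]; exact hd _ ih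
    refine Submodule.span_le.2 ?_
    rintro _ ⟨k, l, m, a, b, hn, rfl⟩
    refine hr _ _ (hl _ _ (hdk _ _ ?_))
    have hm : 2 ≤ m 0 := by
      have h1 : (l.map fun a => if a = 0 then 0 else 1 - a).sum = 0 := by
        apply List.sum_eq_zero
        intro x hx
        obtain ⟨a, -, rfl⟩ := List.mem_map.1 hx
        split_ifs <;> omega
      have h2 : m.sum (fun b e => e * (1 - b)) = m 0 := by
        rw [Finsupp.sum, Finset.sum_eq_single 0]
        · simp
        · intro b _ hb
          have : 1 - b = 0 := by omega
          simp [this]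
        · intro h
          simp [Finsupp.notMem_support_iff.1 h]
      rw [normMono, h1, h2] at hn
      omega
    refine Submodule.subset_span ⟨0, mono l (m - Finsupp.single 0 2), ?_⟩
    have h3 : m - Finsupp.single 0 2 + Finsupp.single 0 2 = m :=
      tsub_add_cancel_of_le (by simpa using hm)
    simp only [mono, rel, Function.iterate_zero, id_eq, Algebra.TensorProduct.tmul_mul_tmul,
      mul_one, MvPolynomial.X_pow_eq_monomial, MvPolynomial.monomial_mul, h3]
  · refine Submodule.span_le.2 ?_
    rintro _ ⟨k, y, rfl⟩
    refine Submodule.subset_span ⟨k, [], Finsupp.single 0 2, y, 1, by simp [normMono], ?_⟩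
    have h : mono [] (Finsupp.single 0 2) = (1 : HAlg) ⊗ₜ[ℝ] (MvPolynomial.X 0 ^ 2 : CAlg) := by
      simp [mono, MvPolynomial.X_pow_eq_monomial]
    rw [h, deltaFree_pow_rel, mul_one]

theorem relIdeal_le_comap (f : Free →ₗ[ℝ] Free)
    (hf : ∀ k y, f (y * ((1 : HAlg) ⊗ₜ[ℝ] rel k)) ∈ relIdeal) :
    relIdeal ≤ relIdeal.comap f := by
  conv_lhs => rw [relIdeal_eq]
  refine Submodule.span_le.2 ?_
  rintro _ ⟨k, y, rfl⟩
  exact hf k y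

theorem mul_rel_mem (k : ℕ) (y : Free) : y * ((1 : HAlg) ⊗ₜ[ℝ] rel k) ∈ relIdeal := by
  rw [relIdeal_eq]
  exact Submodule.subset_span ⟨k, y, rfl⟩

theorem d_relIdeal : relIdeal ≤ relIdeal.comap dFree :=
  relIdeal_le_comap _ fun k y => by rw [dFree_mul_c]; exact mul_rel_mem _ _

theorem delta_relIdeal : relIdeal ≤ relIdeal.comap deltaFree :=
  relIdeal_le_comap _ fun k y => by
    rw [deltaFree, der_mul, der_c, ← rel_succ]
    exact relIdeal.add_mem (mul_rel_mem _ _) (mul_rel_mem _ _)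

theorem sigma_relIdeal : relIdeal ≤ relIdeal.comap sigmaFree :=
  relIdeal_le_comap _ fun k y => by
    rw [sigmaFree, der_mul, der_c]
    refine relIdeal.add_mem (mul_rel_mem _ _) ?_
    rcases k with _ | k
    · rw [sigma_rel_zero]; simp
    · obtain ⟨r, hr⟩ := sigma_rel_succ k
      rw [hr, TensorProduct.tmul_smul, mul_smul_comm]
      exact relIdeal.smul_mem _ (mul_rel_mem _ _)

/-! ### The quotient complex `D^∞W_1` and its cohomology -/

/-- `D^∞W_1`, the quotient of `⋀[h_(a)] ⊗ ℝ[c_(b)]` by the ideal of relations. -/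
abbrev DW : Type := Free ⧸ relIdeal

/-- The differential of `D^∞W_1`. -/
def dDW : DW →ₗ[ℝ] DW := relIdeal.mapQ relIdeal dFree d_relIdeal

/-- `δ` on `D^∞W_1`. -/
def deltaDW : DW →ₗ[ℝ] DW := relIdeal.mapQ relIdeal deltaFree delta_relIdeal

/-- `σ` on `D^∞W_1`. -/
def sigmaDW : DW →ₗ[ℝ] DW := relIdeal.mapQ relIdeal sigmaFree sigma_relIdeal

theorem dDW_dDW (x : DW) : dDW (dDW x) = 0 := by
  obtain ⟨y, rfl⟩ := relIdeal.mkQ_surjective x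
  simp [dDW, dFree_dFree]

theorem deltaDW_dDW (x : DW) : deltaDW (dDW x) = dDW (deltaDW x) := by
  obtain ⟨y, rfl⟩ := relIdeal.mkQ_surjective x
  simp [dDW, deltaDW, deltaFree, der_dFree]

theorem sigmaDW_dDW (x : DW) : sigmaDW (dDW x) = dDW (sigmaDW x) := by
  obtain ⟨y, rfl⟩ := relIdeal.mkQ_surjective x
  simp [dDW, sigmaDW, sigmaFree, der_dFree]

/-- The cocycles of `D^∞W_1`. -/
abbrev Cocycles : Submodule ℝ DW := LinearMap.ker dDW

/-- The coboundaries of `D^∞W_1`, as a subspace of the cocycles. -/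
abbrev Coboundaries : Submodule ℝ Cocycles := (LinearMap.range dDW).submoduleOf Cocycles

/-- The total cohomology `H^*(D^∞W_1)`, the sum over all degrees. -/
abbrev Coh : Type := Cocycles ⧸ Coboundaries

theorem map_cocycles (f : DW →ₗ[ℝ] DW) (hf : ∀ x, f (dDW x) = dDW (f x)) :
    ∀ x ∈ Cocycles, f x ∈ Cocycles := by
  intro x hx
  rw [LinearMap.mem_ker] at hx ⊢
  rw [← hf, hx, map_zero]

theorem map_coboundaries (f : DW →ₗ[ℝ] DW) (hf : ∀ x, f (dDW x) = dDW (f x)) :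
    Coboundaries ≤ Coboundaries.comap (f.restrict (map_cocycles f hf)) := by
  rintro ⟨x, hx⟩ ⟨y, hy⟩
  refine ⟨f y, ?_⟩
  rw [← hf, hy]
  rfl

/-- The map induced on the cohomology by an endomorphism that commutes with the differential. -/
def cohMap (f : DW →ₗ[ℝ] DW) (hf : ∀ x, f (dDW x) = dDW (f x)) : Coh →ₗ[ℝ] Coh :=
  Submodule.mapQ Coboundaries Coboundaries (f.restrict (map_cocycles f hf)) (map_coboundaries f hf)

/-- `δ` on `H^*(D^∞W_1)`. -/
def delta : Coh →ₗ[ℝ] Coh := cohMap deltaDW deltaDW_dDW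

/-- `σ` on `H^*(D^∞W_1)`. -/
def sigma : Coh →ₗ[ℝ] Coh := cohMap sigmaDW sigmaDW_dDW

/-- The subspace of `⋀[h_(a)] ⊗ ℝ[c_(b)]` that is spanned by the monomials of order `k`. -/
def freeOrd (k : ℕ) : Submodule ℝ Free :=
  Submodule.span ℝ {z | ∃ (l : List ℕ) (m : ℕ →₀ ℕ), ordMono l m = k ∧ z = mono l m}

/-- The subspace of `D^∞W_1` of elements of order `k`. -/
def dwOrd (k : ℕ) : Submodule ℝ DW := (freeOrd k).map relIdeal.mkQ

/-- The subspace `H^*(D^∞W_1)^k` of the classes of cocycles of order `k`. -/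
def cohOrd (k : ℕ) : Submodule ℝ Coh :=
  ((dwOrd k).submoduleOf Cocycles).map Coboundaries.mkQ

/-- `F_{λ,k}`, the part of order `k` of the `λ`-eigenspace of `δ ∘ σ` on `H^*(D^∞W_1)`. -/
def F (lam : ℝ) (k : ℕ) : Submodule ℝ Coh :=
  Module.End.eigenspace (delta ∘ₗ sigma) lam ⊓ cohOrd k

end DefW

end

noncomputable section

namespace DefW

open MvPolynomial (X)

/-! The commutator of `σ` and `δ` is a derivation, and on each generator it multiplies by the index.
So `σδ = δσ + k` on order `k` (`sigmaFree_deltaFree`, passed to cohomology in `sigma_delta`). If `g`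
has order `k` and `δσg = rg`, then `δg` has order `k + 1` and satisfies the eigenvalue equation for
`r + k` (`delta_sigma_delta`). Moreover `δg = 0` forces `(r + k)g = 0`, hence `g = 0` when `r + k ≠
0` (`eq_zero_of_delta_eq_zero`). Eigenvalue 0 in order 2 thus becomes 2 in order 3 and 5 in order 4;
eigenvalue 0 in order 3 becomes 3 in order 4.

It remains to exclude the eigenvalues 0, 3 and 5 in order 4, where `δσ` is in fact multiplication by
6 (`delta_sigma_four`). The cohomology there is spanned by the classes of `gam = δ⁴(h_(0) c_(0))`
and `bet = δ³(h_(0) h_(1) c_(0))` (`cocycle_four`). The seeds are cocycles killed by `σ`, of orders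
0 and 1, so the commutation relation gives the eigenvalues 0 + 1 + 2 + 3 and 1 + 2 + 3, both equal
to 6.

The spanning statement is finite linear algebra. The relations reduce the order-four cochains to 26
normal forms. Twelve of these have linearly independent differentials (`eq_zero_of_dDW_complement`),
and together with their differentials and with `gam` and `bet` they span all 26 (`dwOrd_four_le`). A
cocycle therefore has no component on the twelve. -/

/-- The generator `h_(a)` of the exterior algebra. -/
abbrev h (a : ℕ) : HAlg := hLin (Finsupp.single a 1)

/-! ### Monomials and the order grading -/

theorem mono_nil_zero : mono [] 0 = 1 := rfl

theorem mono_cons (a : ℕ) (l : List ℕ) (m : ℕ →₀ ℕ) :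
    mono (a :: l) m = (h a ⊗ₜ[ℝ] (1 : CAlg)) * mono l m := by
  simp [mono]

theorem mono_single_add (b : ℕ) (m : ℕ →₀ ℕ) :
    mono [] (Finsupp.single b 1 + m) = ((1 : HAlg) ⊗ₜ[ℝ] (X b : CAlg)) * mono [] m := by
  simp [mono, MvPolynomial.X, MvPolynomial.monomial_mul]

theorem ordMono_cons (a : ℕ) (l : List ℕ) (m : ℕ →₀ ℕ) :
    ordMono (a :: l) m = a + ordMono l m := by
  simp [ordMono, add_assoc]

theorem ordMono_single_add (b : ℕ) (l : List ℕ) (m : ℕ →₀ ℕ) :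
    ordMono l (Finsupp.single b 1 + m) = b + ordMono l m := by
  rw [ordMono, Finsupp.sum_add_index' (by simp) (by intros; ring), ordMono]
  simp
  omega

/-- Induction on exponents, one variable at a time. -/
theorem expInd {P : (ℕ →₀ ℕ) → Prop} (h0 : P 0)
    (hs : ∀ b m, P m → P (Finsupp.single b 1 + m)) (m : ℕ →₀ ℕ) : P m := by
  obtain ⟨s, rfl⟩ := Multiset.toFinsupp.surjective m
  induction s using Multiset.induction with
  | empty => simpa using h0
  | cons b s ih =>
    rw [← Multiset.singleton_add, map_add, Multiset.toFinsupp_singleton]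
    exact hs b _ ih

/-- Induction on monomials, one generator at a time. -/
theorem monoInd {P : List ℕ → (ℕ →₀ ℕ) → Prop} (h0 : P [] 0)
    (hs : ∀ b m, P [] m → P [] (Finsupp.single b 1 + m))
    (hc : ∀ a l m, P l m → P (a :: l) m) (l : List ℕ) (m : ℕ →₀ ℕ) : P l m := by
  induction l with
  | nil => exact expInd h0 hs m
  | cons a l ih => exact hc a l m ih

theorem shift_single (u : ℕ → ℝ) (s : ℕ → ℕ) (a : ℕ) :
    shift u s (Finsupp.single a 1) = u a • Finsupp.single (s a) 1 := by
  simp [shift]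

theorem hDer_one (f : (ℕ →₀ ℝ) →ₗ[ℝ] (ℕ →₀ ℝ)) : hDer f (1 : HAlg) = 0 := by
  simpa using hDer_algebraMap f 1

theorem hDer_hLin (f : (ℕ →₀ ℝ) →ₗ[ℝ] (ℕ →₀ ℝ)) (v : ℕ →₀ ℝ) :
    hDer f (hLin v) = hLin (f v) := by
  simpa [hDer_one] using hDer_ι_mul f v 1

theorem hDer_h (u : ℕ → ℝ) (s : ℕ → ℕ) (a : ℕ) :
    hDer (shift u s) (h a) = u a • h (s a) := by
  rw [hDer_hLin, shift_single, map_smul]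

theorem cDer_X (u : ℕ → ℝ) (s : ℕ → ℕ) (a : ℕ) : cDer u s (X a) = u a • X (s a) := by
  simp [cDer]

theorem der_h (u : ℕ → ℝ) (s : ℕ → ℕ) (a : ℕ) :
    der u s (h a ⊗ₜ[ℝ] (1 : CAlg)) = u a • (h (s a) ⊗ₜ[ℝ] (1 : CAlg)) := by
  rw [der_tmul, hDer_h, Derivation.map_one_eq_zero, TensorProduct.tmul_zero, add_zero,
    TensorProduct.smul_tmul']

theorem der_X (u : ℕ → ℝ) (s : ℕ → ℕ) (b : ℕ) :
    der u s ((1 : HAlg) ⊗ₜ[ℝ] (X b : CAlg)) = u b • ((1 : HAlg) ⊗ₜ[ℝ] X (s b)) := by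
  rw [der_c, cDer_X, TensorProduct.tmul_smul]

theorem der_one (u : ℕ → ℝ) (s : ℕ → ℕ) : der u s 1 = 0 := by
  rw [Algebra.TensorProduct.one_def, der_c, Derivation.map_one_eq_zero, TensorProduct.tmul_zero]

/-- The derivation that multiplies each monomial by its order. -/
def ordFree : Free →ₗ[ℝ] Free := der (fun a => (a : ℝ)) id

theorem ordFree_mul (x y : Free) : ordFree (x * y) = ordFree x * y + x * ordFree y :=
  der_mul _ _ x y

theorem deltaFree_mul (x y : Free) : deltaFree (x * y) = deltaFree x * y + x * deltaFree y :=
  der_mul _ _ x y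

theorem deltaFree_h (a : ℕ) :
    deltaFree (h a ⊗ₜ[ℝ] (1 : CAlg)) = h (a + 1) ⊗ₜ[ℝ] (1 : CAlg) := by
  rw [deltaFree, der_h, one_smul]

theorem deltaFree_X (b : ℕ) :
    deltaFree ((1 : HAlg) ⊗ₜ[ℝ] (X b : CAlg)) = (1 : HAlg) ⊗ₜ[ℝ] X (b + 1) := by
  rw [deltaFree, der_X, one_smul]

/-- By the Leibniz rule the eigenvalues of the factors add up, just as orders do. -/
theorem ordFree_mono (l : List ℕ) (m : ℕ →₀ ℕ) :
    ordFree (mono l m) = (ordMono l m : ℝ) • mono l m := by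
  induction l, m using monoInd with
  | h0 => simp [mono_nil_zero, ordFree, der_one, ordMono]
  | hs b m ih =>
    rw [mono_single_add, ordMono_single_add, ordFree_mul, ih, ordFree, der_X, smul_mul_assoc,
      mul_smul_comm, id, ← add_smul, Nat.cast_add]
  | hc a l m ih =>
    rw [mono_cons, ordMono_cons, ordFree_mul, ih, ordFree, der_h, smul_mul_assoc,
      mul_smul_comm, id, ← add_smul, Nat.cast_add]

theorem ordFree_of_mem {k : ℕ} {z : Free} (hz : z ∈ freeOrd k) : ordFree z = (k : ℝ) • z := by
  induction hz using Submodule.span_induction with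
  | mem z hz => obtain ⟨l, m, rfl, rfl⟩ := hz; exact ordFree_mono l m
  | zero => simp
  | add x y _ _ hx hy => rw [map_add, hx, hy, smul_add]
  | smul r x _ hx => rw [map_smul, hx, smul_comm]

theorem mono_mem (l : List ℕ) (m : ℕ →₀ ℕ) : mono l m ∈ freeOrd (ordMono l m) :=
  Submodule.subset_span ⟨l, m, rfl, rfl⟩

theorem h_mul_mem {k : ℕ} (a : ℕ) {z : Free} (hz : z ∈ freeOrd k) :
    (h a ⊗ₜ[ℝ] (1 : CAlg)) * z ∈ freeOrd (a + k) := by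
  induction hz using Submodule.span_induction with
  | mem z hz =>
    obtain ⟨l, m, rfl, rfl⟩ := hz
    rw [← mono_cons, ← ordMono_cons]
    exact mono_mem _ _
  | zero => simp
  | add x y _ _ hx hy => rw [mul_add]; exact add_mem hx hy
  | smul r x _ hx => rw [mul_smul_comm]; exact Submodule.smul_mem _ r hx

theorem c_mul_mem {k : ℕ} (b : ℕ) {z : Free} (hz : z ∈ freeOrd k) :
    ((1 : HAlg) ⊗ₜ[ℝ] (X b : CAlg)) * z ∈ freeOrd (b + k) := by
  induction hz using Submodule.span_induction with
  | mem z hz =>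
    obtain ⟨l, m, rfl, rfl⟩ := hz
    have : ((1 : HAlg) ⊗ₜ[ℝ] (X b : CAlg)) * mono l m = mono l (Finsupp.single b 1 + m) := by
      simp [mono, MvPolynomial.X, MvPolynomial.monomial_mul]
    rw [this, ← ordMono_single_add]
    exact mono_mem _ _
  | zero => simp
  | add x y _ _ hx hy => rw [mul_add]; exact add_mem hx hy
  | smul r x _ hx => rw [mul_smul_comm]; exact Submodule.smul_mem _ r hx

theorem deltaFree_mono (l : List ℕ) (m : ℕ →₀ ℕ) :
    deltaFree (mono l m) ∈ freeOrd (ordMono l m + 1) := by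
  induction l, m using monoInd with
  | h0 => simp [mono_nil_zero, deltaFree, der_one]
  | hs b m ih =>
    rw [mono_single_add, deltaFree_mul, deltaFree_X]
    -- The two Leibniz terms raise the order either in the remaining monomial or in the split-off
    -- factor.
    have e1 : ordMono [] (Finsupp.single b 1 + m) + 1 = b + (ordMono [] m + 1) := by
      rw [ordMono_single_add, add_assoc]
    have e2 : ordMono [] (Finsupp.single b 1 + m) + 1 = (b + 1) + ordMono [] m := by
      rw [ordMono_single_add, add_right_comm]
    exact add_mem (e2 ▸ c_mul_mem (b + 1) (mono_mem _ _)) (e1 ▸ c_mul_mem b ih)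
  | hc a l m ih =>
    rw [mono_cons, deltaFree_mul, deltaFree_h]
    have e1 : ordMono (a :: l) m + 1 = a + (ordMono l m + 1) := by
      rw [ordMono_cons, add_assoc]
    have e2 : ordMono (a :: l) m + 1 = (a + 1) + ordMono l m := by
      rw [ordMono_cons, add_right_comm]
    exact add_mem (e2 ▸ h_mul_mem (a + 1) (mono_mem _ _)) (e1 ▸ h_mul_mem a ih)

theorem deltaFree_mem {k : ℕ} {z : Free} (hz : z ∈ freeOrd k) : deltaFree z ∈ freeOrd (k + 1) := by
  induction hz using Submodule.span_induction with
  | mem z hz => obtain ⟨l, m, rfl, rfl⟩ := hz; exact deltaFree_mono l m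
  | zero => simp
  | add x y _ _ hx hy => rw [map_add]; exact add_mem hx hy
  | smul r x _ hx => rw [map_smul]; exact Submodule.smul_mem _ r hx

/-! ### The commutation relation of `σ` and `δ` -/

theorem sigma_delta_coeff (a : ℕ) :
    (1 / 2 : ℝ) * (a + 1 : ℕ) * ((a + 1 : ℕ) - 1) = 1 / 2 * a * (a - 1) + a := by
  push_cast; ring

/-- At `a = 0` truncated subtraction gives `a - 1 + 1 = 1`, but there the coefficient vanishes. -/
theorem coeff_smul_pred {M : Type*} [AddCommGroup M] [Module ℝ M] (f : ℕ → M) (a : ℕ) :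
    ((1 / 2 : ℝ) * a * (a - 1)) • f (a - 1 + 1) = ((1 / 2 : ℝ) * a * (a - 1)) • f a := by
  rcases a with _ | a <;> simp

/-- A commutator of derivations is a derivation, so it is enough to compare on generators, where the
coefficients `½(a+1)a` and `½a(a-1)` differ by `a`. -/
theorem sigmaFree_deltaFree (z : Free) :
    sigmaFree (deltaFree z) = deltaFree (sigmaFree z) + ordFree z := by
  -- The identity passes to products: the mixed terms `σy · δz` and `δy · σz` occur on both sides
  -- and cancel.
  have key (y z : Free) (hy : sigmaFree (deltaFree y) = deltaFree (sigmaFree y) + ordFree y)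
      (hz : sigmaFree (deltaFree z) = deltaFree (sigmaFree z) + ordFree z) :
      sigmaFree (deltaFree (y * z)) = deltaFree (sigmaFree (y * z)) + ordFree (y * z) := by
    simp only [sigmaFree, deltaFree, ordFree, der_mul, map_add] at *
    rw [hy, hz]
    noncomm_ring
  have hh (a : ℕ) : sigmaFree (deltaFree (h a ⊗ₜ[ℝ] (1 : CAlg))) =
      deltaFree (sigmaFree (h a ⊗ₜ[ℝ] (1 : CAlg))) + ordFree (h a ⊗ₜ[ℝ] (1 : CAlg)) := by
    simp only [sigmaFree, deltaFree, ordFree, der_h, map_smul, one_smul, Nat.add_sub_cancel, id]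
    rw [sigma_delta_coeff, add_smul, coeff_smul_pred fun a => h a ⊗ₜ[ℝ] (1 : CAlg)]
  have hX (b : ℕ) : sigmaFree (deltaFree ((1 : HAlg) ⊗ₜ[ℝ] (X b : CAlg))) =
      deltaFree (sigmaFree ((1 : HAlg) ⊗ₜ[ℝ] X b)) + ordFree ((1 : HAlg) ⊗ₜ[ℝ] X b) := by
    simp only [sigmaFree, deltaFree, ordFree, der_X, map_smul, one_smul, Nat.add_sub_cancel, id]
    rw [sigma_delta_coeff, add_smul, coeff_smul_pred fun b => (1 : HAlg) ⊗ₜ[ℝ] (X b : CAlg)]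
  induction z using TensorProduct.induction_on with
  | zero => simp
  | add y z hy hz => simp only [map_add, hy, hz]; abel
  | tmul x p =>
    have h1 : sigmaFree (deltaFree 1) = deltaFree (sigmaFree 1) + ordFree 1 := by
      simp [sigmaFree, deltaFree, ordFree, der_one]
    have hx : sigmaFree (deltaFree (x ⊗ₜ[ℝ] (1 : CAlg))) =
        deltaFree (sigmaFree (x ⊗ₜ[ℝ] 1)) + ordFree (x ⊗ₜ[ℝ] 1) := by
      induction x using hInd with
      | h0 r =>
        rw [Algebra.algebraMap_eq_smul_one, ← TensorProduct.smul_tmul',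
          ← Algebra.TensorProduct.one_def]
        simp only [map_smul, h1, smul_add]
      | ha x y hx hy => simp only [TensorProduct.add_tmul, map_add, hx, hy]; abel
      | hm x v hx =>
        have e : (hLin v * x) ⊗ₜ[ℝ] (1 : CAlg) = (hLin v ⊗ₜ[ℝ] 1) * (x ⊗ₜ[ℝ] 1) := by simp
        rw [e]
        refine key _ _ ?_ hx
        clear e
        induction v using Finsupp.induction_linear with
        | zero => simp
        | add v w hv hw => simp only [map_add, TensorProduct.add_tmul, hv, hw]; abel
        | single a r =>
          rw [← mul_one r, ← smul_eq_mul, ← Finsupp.smul_single]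
          simp only [map_smul, ← TensorProduct.smul_tmul']
          rw [hh, smul_add]
    have hp : sigmaFree (deltaFree ((1 : HAlg) ⊗ₜ[ℝ] p)) =
        deltaFree (sigmaFree ((1 : HAlg) ⊗ₜ[ℝ] p)) + ordFree ((1 : HAlg) ⊗ₜ[ℝ] p) := by
      induction p using MvPolynomial.induction_on with
      | C r =>
        rw [← mul_one (MvPolynomial.C r), ← MvPolynomial.smul_eq_C_mul, TensorProduct.tmul_smul,
          ← Algebra.TensorProduct.one_def]
        simp only [map_smul, h1, smul_add]
      | add p q hp hq => simp only [TensorProduct.tmul_add, map_add, hp, hq]; abel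
      | mul_X p b hp =>
        have e : (1 : HAlg) ⊗ₜ[ℝ] (p * X b) = (1 ⊗ₜ[ℝ] p) * (1 ⊗ₜ[ℝ] (X b : CAlg)) := by simp
        rw [e]
        exact key _ _ hp (hX b)
    have e : x ⊗ₜ[ℝ] p = (x ⊗ₜ[ℝ] 1) * (1 ⊗ₜ[ℝ] p) := by simp
    rw [e]
    exact key _ _ hx hp

/-! ### The commutation relation in cohomology and its effect on eigenvalues -/

theorem deltaDW_mem {k : ℕ} {x : DW} (hx : x ∈ dwOrd k) : deltaDW x ∈ dwOrd (k + 1) := by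
  obtain ⟨z, hz, rfl⟩ := hx
  exact ⟨deltaFree z, deltaFree_mem hz, rfl⟩

theorem sigmaDW_deltaDW {k : ℕ} {x : DW} (hx : x ∈ dwOrd k) :
    sigmaDW (deltaDW x) = deltaDW (sigmaDW x) + (k : ℝ) • x := by
  obtain ⟨z, hz, rfl⟩ := hx
  rw [← map_smul, ← ordFree_of_mem hz]
  exact congrArg relIdeal.mkQ (sigmaFree_deltaFree z)

theorem delta_mem {k : ℕ} {g : Coh} (hg : g ∈ cohOrd k) : delta g ∈ cohOrd (k + 1) := by
  obtain ⟨x, hx, rfl⟩ := hg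
  exact ⟨⟨deltaDW x, map_cocycles _ deltaDW_dDW _ x.2⟩, deltaDW_mem hx, rfl⟩

theorem sigma_delta {k : ℕ} {g : Coh} (hg : g ∈ cohOrd k) :
    sigma (delta g) = delta (sigma g) + (k : ℝ) • g := by
  obtain ⟨x, hx, rfl⟩ := hg
  exact congrArg Coboundaries.mkQ (Subtype.ext (sigmaDW_deltaDW hx))

/-- Here `0 = σδg = δσg + kg = (r + k)g`. -/
theorem eq_zero_of_delta_eq_zero {k : ℕ} {g : Coh} {r : ℝ} (hg : g ∈ cohOrd k)
    (hr : delta (sigma g) = r • g) (hk : r + k ≠ 0) (h0 : delta g = 0) : g = 0 := by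
  have h1 := sigma_delta hg
  rw [h0, map_zero, hr, ← add_smul] at h1
  exact (smul_eq_zero.1 h1.symm).resolve_left hk

theorem delta_sigma_delta {k : ℕ} {g : Coh} {r : ℝ} (hg : g ∈ cohOrd k)
    (hr : delta (sigma g) = r • g) : delta (sigma (delta g)) = (r + k) • delta g := by
  rw [sigma_delta hg, map_add, hr, map_smul, map_smul, add_smul]

/-! ### Computation with classes of tensors -/

/-- The class of `w ⊗ p` in `D^∞W_1`. -/
def cls : HAlg →ₗ[ℝ] CAlg →ₗ[ℝ] DW := (TensorProduct.mk ℝ HAlg CAlg).compr₂ relIdeal.mkQ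

theorem cls_apply (w : HAlg) (p : CAlg) : cls w p = relIdeal.mkQ (w ⊗ₜ[ℝ] p) := rfl

theorem cls_mul_rel (w : HAlg) (p : CAlg) (k : ℕ) : cls w (p * rel k) = 0 := by
  rw [cls_apply, Submodule.mkQ_apply, Submodule.Quotient.mk_eq_zero]
  simpa using mul_rel_mem k (w ⊗ₜ[ℝ] p)

theorem rel_zero : rel 0 = X 0 * X 0 := by simp [rel, pow_two]

theorem rel_one : rel 1 = (2 : ℝ) • (X 0 * X 1) := by
  rw [rel_succ, rel_zero]
  simp [cDer_X]
  module

theorem rel_two : rel 2 = (2 : ℝ) • (X 1 * X 1 + X 0 * X 2) := by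
  rw [rel_succ, rel_one]
  simp [cDer_X]
  module

theorem rel_three : rel 3 = (2 : ℝ) • (X 0 * X 3) + (6 : ℝ) • (X 1 * X 2) := by
  rw [rel_succ, rel_two]
  simp [cDer_X, mul_comm]
  module

theorem rel_four :
    rel 4 = (2 : ℝ) • (X 0 * X 4) + (8 : ℝ) • (X 1 * X 3) + (6 : ℝ) • (X 2 * X 2) := by
  rw [rel_succ, rel_three]
  simp [cDer_X, mul_comm]
  module

/-- This rule and the next four solve the relations of orders 0 to 4 for `c₀²`, `c₀c₁`, `c₁²`,
`c₁c₂` and `c₂²`. An arbitrary factor `p` is kept so that cubic consequences can be drawn. -/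
theorem cls_00 (w : HAlg) (p : CAlg) : cls w (p * (X 0 * X 0)) = 0 := by
  rw [← rel_zero, cls_mul_rel]

theorem cls_01 (w : HAlg) (p : CAlg) : cls w (p * (X 0 * X 1)) = 0 := by
  have := cls_mul_rel w p 1
  rw [rel_one, mul_smul_comm, map_smul] at this
  exact (smul_eq_zero.1 this).resolve_left two_ne_zero

theorem cls_11 (w : HAlg) (p : CAlg) :
    cls w (p * (X 1 * X 1)) = -cls w (p * (X 0 * X 2)) := by
  have := cls_mul_rel w p 2
  rw [rel_two, mul_smul_comm, mul_add, map_smul, map_add] at this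
  exact eq_neg_of_add_eq_zero_left ((smul_eq_zero.1 this).resolve_left two_ne_zero)

theorem cls_12 (w : HAlg) (p : CAlg) :
    cls w (p * (X 1 * X 2)) = -(1 / 3 : ℝ) • cls w (p * (X 0 * X 3)) := by
  have := cls_mul_rel w p 3
  simp only [rel_three, mul_smul_comm, mul_add, map_smul, map_add] at this
  linear_combination (norm := module) (1 / 6 : ℝ) • this

theorem cls_22 (w : HAlg) (p : CAlg) : cls w (p * (X 2 * X 2)) =
    -(1 / 3 : ℝ) • cls w (p * (X 0 * X 4)) - (4 / 3 : ℝ) • cls w (p * (X 1 * X 3)) := by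
  have := cls_mul_rel w p 4
  simp only [rel_four, mul_smul_comm, mul_add, map_smul, map_add] at this
  linear_combination (norm := module) (1 / 6 : ℝ) • this

/-- Products of two variables of order at most four, in normal form. -/
theorem cls_quadratic (w : HAlg) :
    cls w (X 0 * X 0) = 0 ∧ cls w (X 0 * X 1) = 0 ∧
    cls w (X 1 * X 1) = -cls w (X 0 * X 2) ∧
    cls w (X 1 * X 2) = -(1 / 3 : ℝ) • cls w (X 0 * X 3) ∧
    cls w (X 2 * X 2) = -(1 / 3 : ℝ) • cls w (X 0 * X 4) - (4 / 3 : ℝ) • cls w (X 1 * X 3) :=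
  ⟨by simpa using cls_00 w 1, by simpa using cls_01 w 1, by simpa using cls_11 w 1,
    by simpa using cls_12 w 1, by simpa using cls_22 w 1⟩

theorem cls_0_mul (w : HAlg) (b : ℕ) :
    cls w (X 0 * (X 0 * X b)) = 0 ∧ cls w (X 1 * (X 0 * X b)) = 0 := by
  constructor
  · rw [← cls_00 w (X b)]; ring_nf
  · rw [← cls_01 w (X b)]; ring_nf

/-- Multiplying the rule for `c₂²` by `c₀` produces only terms divisible by `c₀²` or `c₀c₁`. -/
theorem cls_202 (w : HAlg) : cls w (X 2 * (X 0 * X 2)) = 0 := by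
  have h := cls_22 w (X 0)
  have h1 : (X 0 * (X 1 * X 3) : CAlg) = X 1 * (X 0 * X 3) := by ring
  rw [h1, (cls_0_mul w _).1, (cls_0_mul w _).2, smul_zero, smul_zero, sub_zero] at h
  rw [← h]
  ring_nf

theorem cls_013 (w : HAlg) : cls w (X 0 * (X 1 * X 3)) = 0 := by
  rw [← (cls_0_mul w 3).2]
  ring_nf

/-! ### Formulas for the differential and for `δ` on short products -/

theorem dDW_cls (w : HAlg) (p : CAlg) :
    dDW (cls w p) = relIdeal.mkQ (dH w * ((1 : HAlg) ⊗ₜ[ℝ] p)) := rfl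

theorem cLin_single (a : ℕ) : cLin (Finsupp.single a 1) = X a := by simp [cLin]

theorem dH_one : dH (1 : HAlg) = 0 := by simpa using dH_algebraMap 1

theorem dH_h_mul (a : ℕ) (x : HAlg) :
    dH (h a * x) = x ⊗ₜ[ℝ] X a - (h a ⊗ₜ[ℝ] (1 : CAlg)) * dH x := by
  rw [dH_ι_mul, cLin_single]

theorem dH_h (a : ℕ) : dH (h a) = (1 : HAlg) ⊗ₜ[ℝ] X a := by
  simpa [dH_one] using dH_h_mul a 1

theorem dDW_h (a : ℕ) (p : CAlg) : dDW (cls (h a) p) = cls 1 (X a * p) := by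
  rw [dDW_cls, dH_h]
  simp [cls_apply]

theorem dDW_hh (a b : ℕ) (p : CAlg) :
    dDW (cls (h a * h b) p) = cls (h b) (X a * p) - cls (h a) (X b * p) := by
  rw [dDW_cls, dH_h_mul, dH_h]
  simp [cls_apply, sub_mul]

theorem dDW_hhh (a b c : ℕ) (p : CAlg) : dDW (cls (h a * (h b * h c)) p) =
    cls (h b * h c) (X a * p) - cls (h a * h c) (X b * p) + cls (h a * h b) (X c * p) := by
  rw [dDW_cls, dH_h_mul, dH_h_mul, dH_h]
  simp [cls_apply, sub_mul, mul_sub]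
  abel

theorem deltaDW_h (a b : ℕ) : deltaDW (cls (h a) (X b)) =
    cls (h (a + 1)) (X b) + cls (h a) (X (b + 1)) := by
  have : deltaFree (h a ⊗ₜ[ℝ] X b) = h (a + 1) ⊗ₜ[ℝ] X b + h a ⊗ₜ[ℝ] X (b + 1) := by
    rw [deltaFree, der_tmul, hDer_h, cDer_X, one_smul, one_smul]
  exact congrArg relIdeal.mkQ this

theorem deltaDW_hh (a b c : ℕ) : deltaDW (cls (h a * h b) (X c)) =
    cls (h (a + 1) * h b) (X c) + cls (h a * h (b + 1)) (X c) +
      cls (h a * h b) (X (c + 1)) := by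
  have : deltaFree ((h a * h b) ⊗ₜ[ℝ] X c) =
      (h (a + 1) * h b) ⊗ₜ[ℝ] X c + (h a * h (b + 1)) ⊗ₜ[ℝ] X c +
        (h a * h b) ⊗ₜ[ℝ] X (c + 1) := by
    rw [deltaFree, der_tmul, hDer_mul, hDer_h, hDer_h, cDer_X, one_smul, one_smul, one_smul,
      TensorProduct.add_tmul]
  exact congrArg relIdeal.mkQ this

theorem h_sq (a : ℕ) : h a * h a = 0 := hLin_sq _

theorem h_swap (a b : ℕ) : h a * h b = -(h b * h a) :=
  eq_neg_of_add_eq_zero_left (ExteriorAlgebra.ι_add_mul_swap _ _)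

theorem h_sq_mul (a : ℕ) (x : HAlg) : h a * (h a * x) = 0 := by
  rw [← mul_assoc, h_sq, zero_mul]

theorem h_swap_mul (a b : ℕ) (x : HAlg) : h a * (h b * x) = -(h b * (h a * x)) := by
  rw [← mul_assoc, h_swap, neg_mul, mul_assoc]

/-! ### Normal forms of order at most four -/

/-- A basis of the part of order `k` of the exterior algebra, for `k ≤ 4`. -/
def hBasis : ℕ → Set HAlg
  | 0 => {1, h 0}
  | 1 => {h 1, h 0 * h 1}
  | 2 => {h 2, h 0 * h 2}
  | 3 => {h 3, h 0 * h 3, h 1 * h 2, h 0 * (h 1 * h 2)}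
  | 4 => {h 4, h 0 * h 4, h 1 * h 3, h 0 * (h 1 * h 3)}
  | _ => ∅

/-- A basis of the part of order `k` of the polynomial algebra modulo the relations, for
`k ≤ 4`. -/
def cBasis : ℕ → Set CAlg
  | 0 => {1, X 0}
  | 1 => {X 1}
  | 2 => {X 2, X 0 * X 2}
  | 3 => {X 3, X 0 * X 3}
  | 4 => {X 4, X 0 * X 4, X 1 * X 3}
  | _ => ∅

/-- Anticommutation sorts the indices up to sign, and a repeated index gives zero; in order at most
four this is a finite check. -/
theorem h_mul_hBasis {a k : ℕ} (hak : a + k ≤ 4) {w : HAlg} (hw : w ∈ hBasis k) :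
    ∃ w' ∈ hBasis (a + k), h a * w = w' ∨ h a * w = -w' ∨ h a * w = 0 := by
  have ha : a ≤ 4 := by omega
  have hk : k ≤ 4 := by omega
  interval_cases a <;> interval_cases k <;> first
    | omega
    | (simp only [hBasis, Set.mem_insert_iff, Set.mem_singleton_iff] at hw ⊢
       rcases hw with rfl | rfl | rfl | rfl <;>
       simp [h_sq_mul, h_swap 1 0, h_swap 2 0, h_swap 3 0, h_swap 4 0, h_swap 2 1, h_swap 3 1,
         h_swap_mul 1 0, h_swap_mul 2 0, h_swap_mul 3 0])

/-- The span of the normal forms of order `k` in `D^∞W_1`, for `k ≤ 4`. -/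
def normalForms (k : ℕ) : Submodule ℝ DW :=
  Submodule.span ℝ {x | ∃ i j, ∃ w ∈ hBasis i, ∃ p ∈ cBasis j, i + j = k ∧ x = cls w p}

theorem cls_mem_normalForms {i j k : ℕ} {w : HAlg} {p : CAlg} (hw : w ∈ hBasis i)
    (hp : p ∈ cBasis j) (hk : i + j = k) : cls w p ∈ normalForms k :=
  Submodule.subset_span ⟨i, j, w, hw, p, hp, hk, rfl⟩

/-- Quadratic products reduce by the five solved relations, and every cubic product that arises
vanishes. The exterior factor `w` stays fixed, so the reduction concerns the polynomial part only.
-/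
theorem cls_X_mul_cBasis {b k : ℕ} (hbk : b + k ≤ 4) (w : HAlg) {p : CAlg} (hp : p ∈ cBasis k) :
    cls w (X b * p) ∈ Submodule.span ℝ (cls w '' cBasis (b + k)) := by
  have hb : b ≤ 4 := by omega
  have hk : k ≤ 4 := by omega
  have hsub {q : CAlg} {n : ℕ} (hq : q ∈ cBasis n) :
      cls w q ∈ Submodule.span ℝ (cls w '' cBasis n) :=
    Submodule.subset_span ⟨q, hq, rfl⟩
  have m1 : cls w (X 0 * X 2) ∈ Submodule.span ℝ (cls w '' cBasis 2) := hsub (by simp [cBasis])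
  have m2 : cls w (X 0 * X 3) ∈ Submodule.span ℝ (cls w '' cBasis 3) := hsub (by simp [cBasis])
  have m3 : cls w (X 0 * X 4) ∈ Submodule.span ℝ (cls w '' cBasis 4) := hsub (by simp [cBasis])
  have m4 : cls w (X 1 * X 3) ∈ Submodule.span ℝ (cls w '' cBasis 4) := hsub (by simp [cBasis])
  have m5 : cls w (X 2 * X 2) ∈ Submodule.span ℝ (cls w '' cBasis 4) := by
    rw [(cls_quadratic w).2.2.2.2]
    exact sub_mem (Submodule.smul_mem _ _ m3) (Submodule.smul_mem _ _ m4)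
  have e (a b : ℕ) : (X a * X b : CAlg) = X b * X a := mul_comm _ _
  obtain ⟨q00, q01, q11, q12, -⟩ := cls_quadratic w
  have c2 := cls_202 w
  have c3 := cls_013 w
  have c0 := fun b => (cls_0_mul w b).1
  have c1 := fun b => (cls_0_mul w b).2
  interval_cases b <;> interval_cases k <;> first
    | omega
    | (simp only [cBasis, Set.mem_insert_iff, Set.mem_singleton_iff] at hp
       rcases hp with rfl | rfl | rfl <;> first
       | (refine hsub ?_; simp [cBasis]; done)
       | (refine hsub ?_; simp [cBasis, mul_comm]; done)
       | (simp [q00, q01, c0, c1, c2, c3]; done)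
       | (simp [e 1 0, q01]; done)
       | exact m5
       | (rw [q11]; exact neg_mem m1)
       | (rw [q12]; exact Submodule.smul_mem _ _ m2)
       | (rw [e, q12]; exact Submodule.smul_mem _ _ m2))

/-- Left multiplication on `D^∞W_1`. -/
def leftMul (y : Free) : DW →ₗ[ℝ] DW :=
  relIdeal.mapQ relIdeal (LinearMap.mulLeft ℝ y)
    (relIdeal_le_comap _ fun k z => by
      rw [LinearMap.mulLeft_apply, ← mul_assoc]
      exact mul_rel_mem _ _)

theorem leftMul_mk (y z : Free) : leftMul y (relIdeal.mkQ z) = relIdeal.mkQ (y * z) := rfl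

theorem leftMul_c (b : ℕ) (w : HAlg) (p : CAlg) :
    leftMul ((1 : HAlg) ⊗ₜ[ℝ] X b) (cls w p) = cls w (X b * p) := by
  rw [cls_apply, leftMul_mk, cls_apply]
  simp

theorem leftMul_h (a : ℕ) (w : HAlg) (p : CAlg) :
    leftMul (h a ⊗ₜ[ℝ] (1 : CAlg)) (cls w p) = cls (h a * w) p := by
  rw [cls_apply, leftMul_mk, cls_apply]
  simp

theorem leftMul_c_mem {b k : ℕ} (hbk : b + k ≤ 4) {x : DW} (hx : x ∈ normalForms k) :
    leftMul ((1 : HAlg) ⊗ₜ[ℝ] X b) x ∈ normalForms (b + k) := by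
  induction hx using Submodule.span_induction with
  | mem x hx =>
    obtain ⟨i, j, w, hw, p, hp, rfl, rfl⟩ := hx
    rw [leftMul_c]
    refine Submodule.span_le.2 ?_ (cls_X_mul_cBasis (by omega) w hp)
    rintro _ ⟨q, hq, rfl⟩
    exact cls_mem_normalForms hw hq (by omega)
  | zero => simp
  | add x y _ _ hx hy => rw [map_add]; exact add_mem hx hy
  | smul r x _ hx => rw [map_smul]; exact Submodule.smul_mem _ r hx

theorem leftMul_h_mem {a k : ℕ} (hak : a + k ≤ 4) {x : DW} (hx : x ∈ normalForms k) :
    leftMul (h a ⊗ₜ[ℝ] (1 : CAlg)) x ∈ normalForms (a + k) := by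
  induction hx using Submodule.span_induction with
  | mem x hx =>
    obtain ⟨i, j, w, hw, p, hp, rfl, rfl⟩ := hx
    rw [leftMul_h]
    obtain ⟨w', hw', hc⟩ := h_mul_hBasis (show a + i ≤ 4 by omega) hw
    have hm : cls w' p ∈ normalForms (a + (i + j)) := cls_mem_normalForms hw' hp (by omega)
    rcases hc with hc | hc | hc <;> rw [hc]
    · exact hm
    · rw [map_neg, LinearMap.neg_apply]; exact neg_mem hm
    · simp
  | zero => simp
  | add x y _ _ hx hy => rw [map_add]; exact add_mem hx hy
  | smul r x _ hx => rw [map_smul]; exact Submodule.smul_mem _ r hx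

theorem mono_mem_normalForms (l : List ℕ) (m : ℕ →₀ ℕ) :
    ordMono l m ≤ 4 → relIdeal.mkQ (mono l m) ∈ normalForms (ordMono l m) := by
  induction l, m using monoInd with
  | h0 =>
    intro _
    have h1 : (1 : HAlg) ∈ hBasis 0 := by simp [hBasis]
    have h2 : (1 : CAlg) ∈ cBasis 0 := by simp [cBasis]
    exact cls_mem_normalForms h1 h2 (by simp [ordMono])
  | hs b m ih =>
    rw [mono_single_add, ordMono_single_add]
    exact fun hk => leftMul_c_mem hk (ih (by omega))
  | hc a l m ih =>
    rw [mono_cons, ordMono_cons]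
    exact fun hk => leftMul_h_mem hk (ih (by omega))

theorem dwOrd_le_normalForms {k : ℕ} (hk : k ≤ 4) : dwOrd k ≤ normalForms k := by
  rw [dwOrd, freeOrd, Submodule.map_span_le]
  rintro _ ⟨l, m, rfl, rfl⟩
  exact mono_mem_normalForms l m hk

/-! ### Coordinates -/

/-- The `HAlg`-valued coordinate on `D^∞W_1` of a functional that vanishes on the relations. -/
def coord (φ : CAlg →ₗ[ℝ] ℝ) (hφ : ∀ p k, φ (p * rel k) = 0) : DW →ₗ[ℝ] HAlg :=
  relIdeal.liftQ ((TensorProduct.rid ℝ HAlg).toLinearMap ∘ₗ TensorProduct.map LinearMap.id φ) (by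
    rw [relIdeal_eq, Submodule.span_le]
    rintro _ ⟨k, y, rfl⟩
    induction y using TensorProduct.induction_on with
    | zero => simp
    | add y z hy hz => rw [add_mul]; exact add_mem hy hz
    | tmul x p => simp [hφ])

theorem coord_cls (φ : CAlg →ₗ[ℝ] ℝ) (hφ : ∀ p k, φ (p * rel k) = 0) (w : HAlg) (p : CAlg) :
    coord φ hφ (cls w p) = φ p • w := by
  simp [coord, cls_apply]

/-- Evaluation at the origin. -/
def ev : CAlg →ₐ[ℝ] ℝ := MvPolynomial.aeval (fun _ => 0)

theorem ev_X (a : ℕ) : ev (X a) = 0 := by simp [ev]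

/-- The first partial derivatives at the origin. -/
def lin (a : ℕ) : CAlg →ₗ[ℝ] ℝ := ev.toLinearMap ∘ₗ (MvPolynomial.pderiv a).toLinearMap

/-- The second partial derivatives at the origin. -/
def quad (a b : ℕ) : CAlg →ₗ[ℝ] ℝ := lin a ∘ₗ (MvPolynomial.pderiv b).toLinearMap

theorem lin_apply (a : ℕ) (p : CAlg) : lin a p = ev (MvPolynomial.pderiv a p) := rfl

theorem quad_apply (a b : ℕ) (p : CAlg) : quad a b p = lin a (MvPolynomial.pderiv b p) := rfl

theorem lin_mul (a : ℕ) (p q : CAlg) : lin a (p * q) = ev p * lin a q + ev q * lin a p := by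
  simp [lin_apply]

theorem quad_mul (a b : ℕ) (p q : CAlg) : quad a b (p * q) =
    ev p * quad a b q + lin a p * lin b q + lin a q * lin b p + ev q * quad a b p := by
  simp only [quad_apply, Derivation.leibniz, smul_eq_mul, map_add, lin_mul, ← lin_apply]
  ring

theorem lin_X (a b : ℕ) : lin a (X b) = if a = b then 1 else 0 := by
  rw [lin_apply, MvPolynomial.pderiv_X, Pi.single_apply]
  split_ifs <;> simp_all

theorem quad_X (a b c : ℕ) : quad a b (X c) = 0 := by
  rw [quad_apply, MvPolynomial.pderiv_X, Pi.single_apply]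
  split_ifs <;> simp [lin_apply]

theorem quad_X_mul_X (a b c e : ℕ) : quad a b (X c * X e) =
    (if a = c ∧ b = e then 1 else 0) + if a = e ∧ b = c then 1 else 0 := by
  rw [quad_mul]
  simp only [ev_X, lin_X, ite_and]
  split_ifs <;> simp

/-- Homogeneity in both degree and order suffices for the coordinates below: a second derivative at
the origin with indices `a`, `b` can detect only the relation of order `a + b`. -/
theorem rel_mem_span (k : ℕ) :
    rel k ∈ Submodule.span ℝ {p : CAlg | ∃ a b, a + b = k ∧ p = X a * X b} := by
  induction k with
  | zero => exact Submodule.subset_span ⟨0, 0, rfl, rel_zero⟩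
  | succ k ih =>
    rw [rel_succ]
    generalize rel k = p at ih
    induction ih using Submodule.span_induction with
    | mem p hp =>
      obtain ⟨a, b, rfl, rfl⟩ := hp
      simp only [Derivation.leibniz, cDer_X, one_smul, smul_eq_mul]
      exact add_mem (Submodule.subset_span ⟨a, b + 1, rfl, rfl⟩)
        (Submodule.subset_span ⟨b, a + 1, by ring, rfl⟩)
    | zero => simp
    | add x y _ _ hx hy => rw [map_add]; exact add_mem hx hy
    | smul r x _ hx => rw [Derivation.map_smul]; exact Submodule.smul_mem _ r hx

theorem eq_zero_of_rel {φ : CAlg →ₗ[ℝ] ℝ} {k : ℕ} (h : ∀ a b, a + b = k → φ (X a * X b) = 0) :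
    φ (rel k) = 0 := by
  have : Submodule.span ℝ {p : CAlg | ∃ a b, a + b = k ∧ p = X a * X b} ≤ LinearMap.ker φ := by
    rw [Submodule.span_le]
    rintro _ ⟨a, b, hab, rfl⟩
    exact h a b hab
  exact this (rel_mem_span k)

theorem ev_rel (k : ℕ) : ev (rel k) = 0 :=
  eq_zero_of_rel (φ := ev.toLinearMap) fun a b _ => by simp [ev_X]

theorem lin_rel (a k : ℕ) : lin a (rel k) = 0 :=
  eq_zero_of_rel fun c e _ => by simp [lin_mul, ev_X]

/-- The relations vanish to second order at the origin, so linear coefficients descend to the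
quotient. -/
theorem lin_mul_rel (a : ℕ) (p : CAlg) (k : ℕ) : lin a (p * rel k) = 0 := by
  rw [lin_mul, lin_rel, ev_rel, mul_zero, zero_mul, add_zero]

theorem quad_rel {a b k : ℕ} (hk : k ≠ a + b) : quad a b (rel k) = 0 :=
  eq_zero_of_rel fun c e hce => by
    rw [quad_X_mul_X, if_neg (by omega), if_neg (by omega), add_zero]

/-- A combination of second derivatives of the same order that kills the relation of that order
kills all relations. -/
theorem quad_sub_mul_rel {a b c e : ℕ} {r : ℝ} (hab : a + b = c + e)
    (hr : quad a b (rel (a + b)) = r * quad c e (rel (a + b))) (p : CAlg) (k : ℕ) :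
    (quad a b - r • quad c e) (p * rel k) = 0 := by
  have h0 : quad a b (rel k) = r * quad c e (rel k) := by
    by_cases hk : k = a + b
    · rw [hk, hr]
    · rw [quad_rel hk, quad_rel (hab ▸ hk), mul_zero]
  simp only [LinearMap.sub_apply, LinearMap.smul_apply, quad_mul, lin_rel, ev_rel, h0, smul_eq_mul]
  ring

def coord₁ (a : ℕ) : DW →ₗ[ℝ] HAlg := coord (lin a) (lin_mul_rel a)

/-- Reads off the coefficient of `c₀c₂` in normal form. The correction by `quad 1 1` makes the
functional kill `rel 2`: the two second derivatives of `rel 2` are 2 and 4, whence `1/2`. The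
constants of the next three coordinates arise in the same way, from 2 and 6, from 2 and 12, and from
8 and 12. -/
def coord02 : DW →ₗ[ℝ] HAlg := coord (quad 0 2 - (1 / 2 : ℝ) • quad 1 1)
  (quad_sub_mul_rel rfl (by simp [rel_two, quad_X_mul_X]; norm_num))

def coord03 : DW →ₗ[ℝ] HAlg := coord (quad 0 3 - (1 / 3 : ℝ) • quad 1 2)
  (quad_sub_mul_rel rfl (by simp [rel_three, quad_X_mul_X]; norm_num))

def coord04 : DW →ₗ[ℝ] HAlg := coord (quad 0 4 - (1 / 6 : ℝ) • quad 2 2)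
  (quad_sub_mul_rel rfl (by simp [rel_four, quad_X_mul_X]; norm_num))

def coord13 : DW →ₗ[ℝ] HAlg := coord (quad 1 3 - (2 / 3 : ℝ) • quad 2 2)
  (quad_sub_mul_rel rfl (by simp [rel_four, quad_X_mul_X]; norm_num))

/-! ### Independence in the exterior algebra -/

theorem h_ne_zero (a : ℕ) : h a ≠ 0 := by
  intro h0
  have := (ExteriorAlgebra.ι_eq_zero_iff (R := ℝ) (Finsupp.single a (1 : ℝ))).1 h0
  simp at this

/-- Contraction with the coordinate dual to `h 0` sends the product to `h a`, which is nonzero. -/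
theorem h_mul_h_ne_zero {a : ℕ} (ha : a ≠ 0) : h 0 * h a ≠ 0 := by
  intro h0
  have h1 := CliffordAlgebra.contractLeft_ι_mul (Q := (0 : QuadraticForm ℝ (ℕ →₀ ℝ)))
    (d := Finsupp.lapply 0) (Finsupp.single 0 1) (h a)
  have h2 := CliffordAlgebra.contractLeft_ι (Q := (0 : QuadraticForm ℝ (ℕ →₀ ℝ)))
    (Finsupp.lapply 0) (Finsupp.single a 1)
  have h3 : (Finsupp.lapply 0 : (ℕ →₀ ℝ) →ₗ[ℝ] ℝ) (Finsupp.single a 1) = 0 := by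
    simp [ha]
  rw [h3, map_zero] at h2
  have h4 : (Finsupp.lapply 0 : (ℕ →₀ ℝ) →ₗ[ℝ] ℝ) (Finsupp.single 0 1) = 1 := by simp
  have h5 : CliffordAlgebra.contractLeft (Q := (0 : QuadraticForm ℝ (ℕ →₀ ℝ))) (Finsupp.lapply 0)
      (h 0 * h a) = h a := by
    refine h1.trans ?_
    rw [h4, one_smul]
    erw [h2]
    simp
  rw [h0, map_zero] at h5
  exact h_ne_zero a h5.symm

/-- Multiplication by `h 0` removes the second term and isolates `r`. -/
theorem pair_one {r s : ℝ} (hrs : r • (1 : HAlg) + s • h 0 = 0) : r = 0 ∧ s = 0 := by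
  have h1 : r • h 0 = 0 := by
    have := congrArg (h 0 * ·) hrs
    simpa [mul_add, h_sq] using this
  have hr := (smul_eq_zero.1 h1).resolve_right (h_ne_zero 0)
  rw [hr, zero_smul, zero_add] at hrs
  exact ⟨hr, (smul_eq_zero.1 hrs).resolve_right (h_ne_zero 0)⟩

theorem pair_h {a : ℕ} (ha : a ≠ 0) {r s : ℝ} (hrs : r • h a + s • (h 0 * h a) = 0) :
    r = 0 ∧ s = 0 := by
  have h1 : r • (h 0 * h a) = 0 := by
    have := congrArg (h 0 * ·) hrs
    simpa [mul_add, h_sq_mul] using this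
  have hr := (smul_eq_zero.1 h1).resolve_right (h_mul_h_ne_zero ha)
  rw [hr, zero_smul, zero_add] at hrs
  exact ⟨hr, (smul_eq_zero.1 hrs).resolve_right (h_mul_h_ne_zero ha)⟩

/-! ### Cohomology of order four -/

/-- The cocycle `δ⁴ (h_(0) c_(0))`. -/
def gam : DW := deltaDW (deltaDW (deltaDW (deltaDW (cls (h 0) (X 0)))))

/-- The cocycle `δ³ (h_(0) h_(1) c_(0))`. -/
def bet : DW := deltaDW (deltaDW (deltaDW (cls (h 0 * h 1) (X 0))))

theorem gam_eq : gam = cls (h 0) (X 4) + (4 : ℝ) • cls (h 1) (X 3) + (6 : ℝ) • cls (h 2) (X 2) +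
    (4 : ℝ) • cls (h 3) (X 1) + cls (h 4) (X 0) := by
  simp only [gam, deltaDW_h, map_add, Nat.reduceAdd]
  module

theorem bet_eq : bet = cls (h 0 * h 1) (X 3) + cls (h 0 * h 4) (X 0) +
    (2 : ℝ) • cls (h 1 * h 3) (X 0) + (3 : ℝ) • cls (h 0 * h 2) (X 2) +
    (3 : ℝ) • cls (h 0 * h 3) (X 1) + (3 : ℝ) • cls (h 1 * h 2) (X 1) := by
  simp only [bet, deltaDW_hh, map_add, Nat.reduceAdd, h_sq, map_zero,
    LinearMap.zero_apply]
  module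

/-- Since `d` commutes with `δ`, only the seed matters, and `d(h₀c₀) = c₀²` is a relation. -/
theorem dDW_gam : dDW gam = 0 := by
  simp only [gam, ← deltaDW_dDW, dDW_h, (cls_quadratic 1).1, map_zero]

/-- The seed has differential `h₁c₀² - h₀c₀c₁`, and both terms vanish modulo the relations. -/
theorem dDW_bet : dDW bet = 0 := by
  simp only [bet, ← deltaDW_dDW, dDW_hh, (cls_quadratic _).1, mul_comm (X 1 : CAlg) (X 0),
    (cls_quadratic _).2.1, map_zero, sub_zero]

theorem cls_h_mem (a b : ℕ) : cls (h a) (X b) ∈ dwOrd (a + b) := by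
  refine ⟨h a ⊗ₜ X b, Submodule.subset_span ⟨[a], Finsupp.single b 1, ?_, ?_⟩, rfl⟩
  · simp [ordMono]
  · simp [mono, MvPolynomial.X]

theorem cls_hh_mem (a b c : ℕ) : cls (h a * h b) (X c) ∈ dwOrd (a + b + c) := by
  refine ⟨(h a * h b) ⊗ₜ X c, Submodule.subset_span ⟨[a, b], Finsupp.single c 1, ?_, ?_⟩, rfl⟩
  · simp [ordMono]
  · simp [mono, MvPolynomial.X]

/-- The coefficient `½a(a-1)` vanishes at `a = 0` and at `a = 1`, so `σ` kills this seed and the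
next one. -/
theorem sigmaDW_h_zero : sigmaDW (cls (h 0) (X 0)) = 0 := by
  have : sigmaFree (h 0 ⊗ₜ[ℝ] X 0) = 0 := by
    rw [sigmaFree, der_tmul, hDer_h, cDer_X]
    simp
  exact (congrArg relIdeal.mkQ this).trans (map_zero _)

theorem sigmaDW_hh_zero : sigmaDW (cls (h 0 * h 1) (X 0)) = 0 := by
  have : sigmaFree ((h 0 * h 1) ⊗ₜ[ℝ] X 0) = 0 := by
    rw [sigmaFree, der_tmul, hDer_mul, hDer_h, hDer_h, cDer_X]
    simp
  exact (congrArg relIdeal.mkQ this).trans (map_zero _)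

/-- Moving `σ` past each `δ` contributes the order of the element below it: `3 + 2 + 1 + 0 = 6`. -/
theorem delta_sigma_gam : deltaDW (sigmaDW gam) = (6 : ℝ) • gam := by
  have h0 := cls_h_mem 0 0
  have h1 := deltaDW_mem h0
  have h2 := deltaDW_mem h1
  have h3 := deltaDW_mem h2
  rw [gam, sigmaDW_deltaDW h3, sigmaDW_deltaDW h2, sigmaDW_deltaDW h1, sigmaDW_deltaDW h0,
    sigmaDW_h_zero]
  simp only [map_add, map_smul, map_zero]
  push_cast
  module

/-- The seed now has order 1, and three transpositions contribute `3 + 2 + 1 = 6`. -/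
theorem delta_sigma_bet : deltaDW (sigmaDW bet) = (6 : ℝ) • bet := by
  have h0 := cls_hh_mem 0 1 0
  have h1 := deltaDW_mem h0
  have h2 := deltaDW_mem h1
  rw [bet, sigmaDW_deltaDW h2, sigmaDW_deltaDW h1, sigmaDW_deltaDW h0, sigmaDW_hh_zero]
  simp only [map_add, map_smul, map_zero]
  push_cast
  module

/-- A basis of a complement of the cocycles in the cochains of order four. -/
def complementBasis : Fin 12 → DW :=
  ![cls (h 4) 1, cls (h 0 * h 4) 1, cls (h 1 * h 3) 1, cls (h 4) (X 0), cls (h 3) (X 1),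
    cls (h 0 * (h 1 * h 3)) 1, cls (h 0 * h 4) (X 0), cls (h 1 * h 3) (X 0), cls (h 0 * h 3) (X 1),
    cls (h 1 * h 2) (X 1), cls (h 0 * (h 1 * h 3)) (X 0), cls (h 0 * (h 1 * h 2)) (X 1)]

theorem dDW_complementBasis : dDW ∘ complementBasis =
    ![cls 1 (X 4), cls (h 4) (X 0) - cls (h 0) (X 4), cls (h 3) (X 1) - cls (h 1) (X 3),
      cls 1 (X 0 * X 4), cls 1 (X 1 * X 3),
      cls (h 1 * h 3) (X 0) - cls (h 0 * h 3) (X 1) + cls (h 0 * h 1) (X 3),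
      -cls (h 0) (X 0 * X 4), -cls (h 1) (X 0 * X 3), -cls (h 0) (X 1 * X 3),
      -cls (h 2) (X 0 * X 2) + (1 / 3 : ℝ) • cls (h 1) (X 0 * X 3),
      cls (h 0 * h 1) (X 0 * X 3),
      cls (h 0 * h 2) (X 0 * X 2) - (1 / 3 : ℝ) • cls (h 0 * h 1) (X 0 * X 3)] := by
  have q0 := fun w => (cls_quadratic w).1
  have q1 := fun w => (cls_quadratic w).2.1
  have q11 := fun w => (cls_quadratic w).2.2.1
  have q12 := fun w => (cls_quadratic w).2.2.2.1
  funext i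
  fin_cases i <;>
    simp [complementBasis, dDW_h, dDW_hh, dDW_hhh, q0, q1, q11, q12, mul_comm (X 4 : CAlg) (X 0),
      mul_comm (X 3 : CAlg) (X 0), mul_comm (X 3 : CAlg) (X 1), mul_comm (X 1 : CAlg) (X 0),
      mul_comm (X 2 : CAlg) (X 1), sub_eq_add_neg]

/-- The differential is injective on the complement. -/
theorem eq_zero_of_dDW_complement {c : Fin 12 → ℝ}
    (hc : dDW (∑ i, c i • complementBasis i) = 0) : c = 0 := by
  have hd (i : Fin 12) := congrFun dDW_complementBasis i
  simp only [Function.comp_apply] at hd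
  simp only [map_sum, map_smul, hd] at hc
  clear hd
  simp [Fin.sum_univ_succ] at hc
  -- Each coordinate collects the terms with one polynomial part, leaving a relation between two
  -- independent exterior elements.
  have k4 := congrArg (coord₁ 4) hc
  have k1 := congrArg (coord₁ 1) hc
  have k02 := congrArg coord02 hc
  have k03 := congrArg coord03 hc
  have k04 := congrArg coord04 hc
  have k13 := congrArg coord13 hc
  simp [coord₁, coord_cls, lin_mul, lin_X, ev_X] at k4 k1
  simp [coord02, coord_cls, quad_X, quad_X_mul_X] at k02
  simp [coord03, coord_cls, quad_X, quad_X_mul_X] at k03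
  simp [coord04, coord_cls, quad_X, quad_X_mul_X] at k04
  simp [coord13, coord_cls, quad_X, quad_X_mul_X] at k13
  obtain ⟨c0, c1⟩ := pair_one (r := c 0) (s := -c 1) (by rw [← k4]; module)
  obtain ⟨c2, c5⟩ := pair_h (a := 3) (r := c 2) (s := -c 5) (by simp) (by rw [← k1]; module)
  obtain ⟨c9, c11⟩ := pair_h (a := 2) (r := -c 9) (s := c 11) (by simp) (by rw [← k02]; module)
  -- The `c₀c₃` component also involves `c 9` and `c 11`, through the rule for `c₁c₂`; these are
  -- already known to vanish.
  obtain ⟨c7, c10⟩ := pair_h (a := 1) (r := -c 7 + c 9 * 3⁻¹) (s := c 10 - c 11 * 3⁻¹) (by simp)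
    (by rw [← k03]; module)
  obtain ⟨c3, c6⟩ := pair_one (r := c 3) (s := -c 6) (by rw [← k04]; module)
  obtain ⟨c4, c8⟩ := pair_one (r := c 4) (s := -c 8) (by rw [← k13]; module)
  funext i
  fin_cases i <;> simp <;> linarith

/-- The coboundaries, the two standard cocycles and the complement together span the cochains of
order four. -/
theorem dwOrd_four_le : dwOrd 4 ≤ (LinearMap.range dDW ⊔ Submodule.span ℝ {gam, bet}) ⊔
    Submodule.span ℝ (Set.range complementBasis) := by
  refine (dwOrd_le_normalForms le_rfl).trans ?_
  set Z := (LinearMap.range dDW ⊔ Submodule.span ℝ {gam, bet}) ⊔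
    Submodule.span ℝ (Set.range complementBasis) with hZ
  have hS (i : Fin 12) : complementBasis i ∈ Z :=
    Submodule.mem_sup_right (Submodule.subset_span ⟨i, rfl⟩)
  have hd (i : Fin 12) : (dDW ∘ complementBasis) i ∈ Z :=
    Submodule.mem_sup_left (Submodule.mem_sup_left ⟨complementBasis i, rfl⟩)
  rw [dDW_complementBasis] at hd
  have hg : gam ∈ Z :=
    Submodule.mem_sup_left (Submodule.mem_sup_right (Submodule.subset_span (by simp)))
  have hb : bet ∈ Z :=
    Submodule.mem_sup_left (Submodule.mem_sup_right (Submodule.subset_span (by simp)))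
  clear_value Z
  have s0 : cls (h 4) 1 ∈ Z := hS 0
  have s1 : cls (h 0 * h 4) 1 ∈ Z := hS 1
  have s2 : cls (h 1 * h 3) 1 ∈ Z := hS 2
  have s3 : cls (h 4) (X 0) ∈ Z := hS 3
  have s4 : cls (h 3) (X 1) ∈ Z := hS 4
  have s5 : cls (h 0 * (h 1 * h 3)) 1 ∈ Z := hS 5
  have s6 : cls (h 0 * h 4) (X 0) ∈ Z := hS 6
  have s7 : cls (h 1 * h 3) (X 0) ∈ Z := hS 7
  have s8 : cls (h 0 * h 3) (X 1) ∈ Z := hS 8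
  have s9 : cls (h 1 * h 2) (X 1) ∈ Z := hS 9
  have s10 : cls (h 0 * (h 1 * h 3)) (X 0) ∈ Z := hS 10
  have s11 : cls (h 0 * (h 1 * h 2)) (X 1) ∈ Z := hS 11
  -- Each differential contributes one further normal form modulo those already obtained.
  have e0 : cls 1 (X 4) ∈ Z := hd 0
  have e1 : cls (h 0) (X 4) ∈ Z := (Z.sub_mem_iff_right s3).1 (hd 1)
  have e2 : cls (h 1) (X 3) ∈ Z := (Z.sub_mem_iff_right s4).1 (hd 2)
  have e3 : cls 1 (X 0 * X 4) ∈ Z := hd 3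
  have e4 : cls 1 (X 1 * X 3) ∈ Z := hd 4
  have e5 : cls (h 0 * h 1) (X 3) ∈ Z := (add_mem_cancel_left (sub_mem s7 s8)).1 (hd 5)
  have e6 : cls (h 0) (X 0 * X 4) ∈ Z := neg_mem_iff.1 (hd 6)
  have e7 : cls (h 1) (X 0 * X 3) ∈ Z := neg_mem_iff.1 (hd 7)
  have e8 : cls (h 0) (X 1 * X 3) ∈ Z := neg_mem_iff.1 (hd 8)
  have e9 : cls (h 2) (X 0 * X 2) ∈ Z :=
    neg_mem_iff.1 ((add_mem_cancel_right (Z.smul_mem _ e7)).1 (hd 9))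
  have e10 : cls (h 0 * h 1) (X 0 * X 3) ∈ Z := hd 10
  have e11 : cls (h 0 * h 2) (X 0 * X 2) ∈ Z :=
    (Z.sub_mem_iff_left (Z.smul_mem _ e10)).1 (hd 11)
  -- All terms of `gam` except `6 h₂c₂` are already available.
  have eg : cls (h 2) (X 2) ∈ Z := by
    rw [gam_eq] at hg
    have := (add_mem_cancel_right (Z.smul_mem 4 s4)).1 ((add_mem_cancel_right s3).1 hg)
    exact (Z.smul_mem_iff (by norm_num : (6 : ℝ) ≠ 0)).1
      ((add_mem_cancel_left (add_mem e1 (Z.smul_mem 4 e2))).1 this)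
  -- All terms of `bet` except `3 h₀h₂c₂` are already available.
  have eb : cls (h 0 * h 2) (X 2) ∈ Z := by
    rw [bet_eq] at hb
    have := (add_mem_cancel_right (Z.smul_mem 3 s8)).1
      ((add_mem_cancel_right (Z.smul_mem 3 s9)).1 hb)
    exact (Z.smul_mem_iff (by norm_num : (3 : ℝ) ≠ 0)).1
      ((add_mem_cancel_left (add_mem (add_mem e5 s6) (Z.smul_mem 2 s7))).1 this)
  clear hd hS hg hb hZ
  refine Submodule.span_le.2 ?_
  rintro _ ⟨i, j, w, hw, p, hp, hij, rfl⟩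
  obtain rfl : j = 4 - i := by omega
  have hi : i ≤ 4 := by omega
  interval_cases i <;>
    simp only [hBasis, cBasis, Nat.reduceSub, Set.mem_insert_iff, Set.mem_singleton_iff] at hw hp <;>
    rcases hw with rfl | rfl | rfl | rfl <;> rcases hp with rfl | rfl | rfl <;> assumption

/-- The component of a cocycle on the complement is itself closed, hence zero by injectivity of `d`
there. -/
theorem cocycle_four {x : DW} (hx : x ∈ dwOrd 4) (hd : dDW x = 0) :
    x ∈ LinearMap.range dDW ⊔ Submodule.span ℝ {gam, bet} := by
  obtain ⟨z, hz, s, hs, rfl⟩ := Submodule.mem_sup.1 (dwOrd_four_le hx)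
  have hz0 : dDW z = 0 := by
    have : LinearMap.range dDW ⊔ Submodule.span ℝ {gam, bet} ≤ LinearMap.ker dDW := by
      refine sup_le ?_ (Submodule.span_le.2 ?_)
      · rintro _ ⟨y, rfl⟩
        exact dDW_dDW y
      · rintro _ (rfl | rfl)
        · exact dDW_gam
        · exact dDW_bet
    exact this hz
  rw [map_add, hz0, zero_add] at hd
  obtain ⟨c, rfl⟩ := (Submodule.mem_span_range_iff_exists_fun ℝ).1 hs
  rw [eq_zero_of_dDW_complement hd]
  simpa using hz

/-- On the cohomology of order four, `δ ∘ σ` is multiplication by six. -/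
theorem delta_sigma_four {g : Coh} (hg : g ∈ cohOrd 4) : delta (sigma g) = (6 : ℝ) • g := by
  obtain ⟨⟨x, hx⟩, hx4, rfl⟩ := hg
  have key : deltaDW (sigmaDW x) - (6 : ℝ) • x ∈ LinearMap.range dDW := by
    obtain ⟨_, ⟨y, rfl⟩, v, hv, rfl⟩ := Submodule.mem_sup.1 (cocycle_four hx4 hx)
    obtain ⟨a, b, rfl⟩ := Submodule.mem_span_pair.1 hv
    -- The operator `δσ - 6` commutes with `d` and kills `gam` and `bet`, so it sends `dy + a gam +
    -- b bet` to `d` of this witness.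
    refine ⟨deltaDW (sigmaDW y) - (6 : ℝ) • y, ?_⟩
    simp only [map_add, map_sub, map_smul, sigmaDW_dDW, deltaDW_dDW, delta_sigma_gam,
      delta_sigma_bet]
    module
  rw [← sub_eq_zero]
  exact (Submodule.Quotient.mk_eq_zero Coboundaries
    (x := ⟨deltaDW (sigmaDW x) - (6 : ℝ) • x, sub_mem (map_cocycles _ deltaDW_dDW _
      (map_cocycles _ sigmaDW_dDW _ hx)) (Submodule.smul_mem _ _ hx)⟩)).2 key

theorem eq_zero_of_eigen_four {g : Coh} {r : ℝ} (hg : g ∈ cohOrd 4) (hr : delta (sigma g) = r • g)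
    (h6 : r ≠ 6) : g = 0 := by
  rw [delta_sigma_four hg, ← sub_eq_zero, ← sub_smul] at hr
  exact (smul_eq_zero.1 hr).resolve_left (sub_ne_zero.2 h6.symm)

theorem F_eq_bot {lam : ℝ} {k : ℕ}
    (hF : ∀ g ∈ cohOrd k, delta (sigma g) = lam • g → g = 0) : F lam k = ⊥ := by
  rw [eq_bot_iff]
  rintro g ⟨h1, h2⟩
  exact hF g h2 (Module.End.mem_eigenspace_iff.1 h1)

end DefW

end

theorem proposition10p6 :
    DefW.F 0 2 = ⊥ ∧ DefW.F 0 3 = ⊥ ∧ DefW.F 0 4 = ⊥ := by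
  refine ⟨DefW.F_eq_bot fun g hg h0 => ?_, DefW.F_eq_bot fun g hg h0 => ?_,
    DefW.F_eq_bot fun g hg h0 => DefW.eq_zero_of_eigen_four hg h0 (by norm_num)⟩
  · have h1 := DefW.delta_sigma_delta hg h0
    have hg1 := DefW.delta_mem hg
    refine DefW.eq_zero_of_delta_eq_zero hg h0 (by norm_num)
      (DefW.eq_zero_of_delta_eq_zero hg1 h1 (by norm_num) ?_)
    exact DefW.eq_zero_of_eigen_four (DefW.delta_mem hg1) (DefW.delta_sigma_delta hg1 h1)
      (by norm_num)
  -- From order 3 the eigenvalue moves from 0 to 3, again different from 6.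
  · exact DefW.eq_zero_of_delta_eq_zero hg h0 (by norm_num)
      (DefW.eq_zero_of_eigen_four (DefW.delta_mem hg) (DefW.delta_sigma_delta hg h0) (by norm_num))
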